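/- Let $\Bbbk$ be an algebraically closed field of characteristic zero. For a non-empty finite subset $A=\{u_0,\dots,u_m\}$ (with $u_0,\dots,u_m$ distinct) of a free abelian group $M$ of finite rank, let $X_A\subset\mathbb{P}^m$ be the Zariski closure of the image of $$\varphi_A: T_M=\operatorname{Spec}\Bbbk[M]\to\mathbb{P}^m,\qquad t\mapsto[z^{u_0}(t):\dots:z^{u_m}(t)],$$ on which the torus acts by $t\cdot[x_0:\dots:x_m]=[z^{u_0}(t)x_0:\dots:z^{u_m}(t)x_m]$. Let $X\subset\mathbb{P}^N$ be a projectively embedded toric variety, i.e. $X$ is projectively equivalent to such an $X_A$: there are linear embeddings $\jmath_1:\mathbb{P}^N\hookrightarrow\mathbb{P}^L$ and $\jmath_2:\mathbb{P}^m\hookrightarrow\mathbb{P}^L$ with $\jmath_1(X)=\jmath_2(X_A)$; let the torus act on $X$ through the identification $X\cong X_A$ given by $\jmath_1,\jmath_2$. Let $n=\dim X$, and let $\gamma:X\dashrightarrow\mathbb{G}(n,\mathbb{P}^N)$ be the Gauss map, which sends a smooth point $x\in X$ to the embedded tangent space $\mathbb{T}_xX\subset\mathbb{P}^N$. Let the Gauss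 defect $\delta=\delta_\gamma(X)$ be the dimension of a general fiber of $\gamma$; that is, for all $x$ in some non-empty open subset of the smooth locus of $X$, the fiber of $\gamma$ through $x$ has dimension $\delta$. Then $\delta$ is well defined, and there exist pairwise disjoint, torus-invariant closed (irreducible, non-empty) subvarieties $X_0,\dots,X_\delta\subset X$ such that $X$ is the join of $X_0,\dots,X_\delta$, i.e. $X$ is the closure in $\mathbb{P}^N$ of the union of the linear spans $\langle x_0,\dots,x_\delta\rangle$ over all $x_0\in X_0,\dots,x_\delta\in X_\delta$. -/

import Mathlib

open scoped LinearAlgebra.Projectivization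

noncomputable section

namespace ToricGauss

section ProjectiveSpace

variable {k : Type*} [Field k] {ι : Type*}

/-- The common zeros in projective space of a set of polynomials; it is used for sets of
homogeneous polynomials only, where the choice of representatives is irrelevant. -/
def zeroLocus (S : Set (MvPolynomial ι k)) : Set (ℙ k (ι → k)) :=
  {p | ∀ f ∈ S, MvPolynomial.eval p.rep f = 0}

/-- The Zariski topology on projective space: the closed sets are the zero loci of sets of
homogeneous polynomials. -/
instance zariskiTopology : TopologicalSpace (ℙ k (ι → k)) :=
  TopologicalSpace.ofClosed
    {Z | ∃ S : Set (MvPolynomial ι k),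
      (∀ f ∈ S, ∃ d : ℕ, f.IsHomogeneous d) ∧ Z = zeroLocus S}
    ⟨{1}, by
      rintro f rfl
      exact ⟨0, MvPolynomial.isHomogeneous_one ι k⟩, by
      ext p
      simp [zeroLocus]⟩
    (by
      intro 𝒵 h𝒵
      have h : ∀ Z ∈ 𝒵, ∃ S : Set (MvPolynomial ι k),
          (∀ f ∈ S, ∃ d : ℕ, f.IsHomogeneous d) ∧ Z = zeroLocus S := fun Z hZ => h𝒵 hZ
      choose! S hS using h
      refine ⟨⋃ Z ∈ 𝒵, S Z, ?_, ?_⟩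
      · intro f hf
        simp only [Set.mem_iUnion] at hf
        obtain ⟨Z, hZ, hf⟩ := hf
        exact (hS Z hZ).1 f hf
      · ext p
        simp only [Set.mem_sInter, zeroLocus, Set.mem_ofPred_eq, Set.mem_iUnion]
        constructor
        · rintro h f ⟨Z, hZ, hf⟩
          have := h Z hZ
          rw [(hS Z hZ).2] at this
          exact this f hf
        · intro h Z hZ
          rw [(hS Z hZ).2]
          exact fun f hf => h f ⟨Z, hZ, hf⟩)
    (by
      rintro _ ⟨S, hS, rfl⟩ _ ⟨S', hS', rfl⟩
      refine ⟨{h | ∃ f ∈ S, ∃ g ∈ S', h = f * g}, ?_, ?_⟩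
      · rintro _ ⟨f, hf, g, hg, rfl⟩
        obtain ⟨a, ha⟩ := hS f hf
        obtain ⟨b, hb⟩ := hS' g hg
        exact ⟨a + b, ha.mul hb⟩
      · ext p
        simp only [Set.mem_union, zeroLocus, Set.mem_ofPred_eq]
        constructor
        · rintro (h | h) _ ⟨f, hf, g, hg, rfl⟩
          · simp [h f hf]
          · simp [h g hg]
        · intro h
          by_contra hcon
          push Not at hcon
          obtain ⟨⟨f, hf, hf0⟩, g, hg, hg0⟩ := hcon
          have := h _ ⟨f, hf, g, hg, rfl⟩
          rw [map_mul] at this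
          exact (mul_ne_zero hf0 hg0) this)

/-- A (closed) projective subvariety of projective space: closed, irreducible, non-empty. -/
def IsProjectiveVariety (X : Set (ℙ k (ι → k))) : Prop :=
  IsClosed X ∧ IsIrreducible X

/-- The embedded join: the closure of the union of the linear spans of `x₁, …, xₘ` with
`xⱼ ∈ Xⱼ`. -/
def join {m : Type*} (X : m → Set (ℙ k (ι → k))) : Set (ℙ k (ι → k)) :=
  closure {p | ∃ x : m → ℙ k (ι → k), (∀ j, x j ∈ X j) ∧
    p ∈ Projectivization.Subspace.span (Set.range x)}

/-- The embedded tangent space of `X` at `x`, as a linear subspace of `k^ι`: the common kernel of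
the differentials at `x` of the homogeneous polynomials that vanish on `X`. -/
def embeddedTangentSpace [Fintype ι] (X : Set (ℙ k (ι → k))) (x : ℙ k (ι → k)) :
    Submodule k (ι → k) where
  carrier := {w | ∀ (f : MvPolynomial ι k) (d : ℕ), f.IsHomogeneous d →
    (∀ p ∈ X, MvPolynomial.eval p.rep f = 0) →
    ∑ i, MvPolynomial.eval x.rep (MvPolynomial.pderiv i f) * w i = 0}
  add_mem' := by
    intro a b ha hb f d hf hX
    simp [mul_add, Finset.sum_add_distrib, ha f d hf hX, hb f d hf hX]
  zero_mem' := by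
    intro f d _ _
    simp
  smul_mem' := by
    intro c w hw f d hf hX
    have := hw f d hf hX
    simp only [Pi.smul_apply, smul_eq_mul, mul_left_comm _ c, ← Finset.mul_sum, this, mul_zero]

/-- The smooth points of `X`: those where the embedded tangent space, of projective dimension
`finrank - 1`, has the dimension of `X`. -/
def smoothLocus [Fintype ι] (X : Set (ℙ k (ι → k))) : Set (ℙ k (ι → k)) :=
  {x | x ∈ X ∧
    ((Module.finrank k (embeddedTangentSpace X x) : ℕ∞) : WithBot ℕ∞) = topologicalKrullDim X + 1}

/-- The fiber through `x` of the Gauss map `y ↦ 𝕋_y X`, which is defined on the smooth points. -/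
def gaussFiber [Fintype ι] (X : Set (ℙ k (ι → k))) (x : ℙ k (ι → k)) : Set (ℙ k (ι → k)) :=
  {y | y ∈ smoothLocus X ∧ embeddedTangentSpace X y = embeddedTangentSpace X x}

/-- `δ` is the Gauss defect of the variety `X`, the dimension of a general fiber of the Gauss map:
for all `x` in some non-empty open subset of `X`, the fiber through `x` has dimension `δ`. -/
def IsGaussDefect [Fintype ι] (X : Set (ℙ k (ι → k))) (δ : ℕ) : Prop :=
  ∃ U : Set (ℙ k (ι → k)), IsOpen U ∧ (X ∩ U).Nonempty ∧
    ∀ x ∈ X ∩ U, x ∈ smoothLocus X ∧ topologicalKrullDim (gaussFiber X x) = ((δ : ℕ∞) : WithBot ℕ∞)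

/-- A variety has at most one Gauss defect. -/
theorem IsGaussDefect.unique [Fintype ι] {X : Set (ℙ k (ι → k))} (hX : IsIrreducible X)
    {a b : ℕ} (ha : IsGaussDefect X a) (hb : IsGaussDefect X b) : a = b := by
  obtain ⟨U, hU, hUX, hUa⟩ := ha
  obtain ⟨V, hV, hVX, hVb⟩ := hb
  obtain ⟨x, hx, hxU, hxV⟩ := hX.2 U V hU hV hUX hVX
  have h := (hUa x ⟨hx, hxU⟩).2.symm.trans (hVb x ⟨hx, hxV⟩).2
  exact_mod_cast h

end ProjectiveSpace

section Toric

variable (k : Type*) [Field k] {M : Type*} [AddCommGroup M]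

/-- The closed points of the algebraic torus `T_M = Spec k[M]` (`k` algebraically closed), that is,
the homomorphisms from `M` to the multiplicative group of `k`; `t (ofAdd u)` is the value of the
monomial `z^u` at `t`. -/
abbrev Torus (M : Type*) [AddCommGroup M] : Type _ := Multiplicative M →* kˣ

variable {k}

/-- The morphism `φ_A : T_M → ℙ^N`, `t ↦ [z^u(t)]_{u ∈ A}`; the homogeneous coordinates of `ℙ^N`,
`N = #A - 1`, are indexed by `A`. -/
def toricMap (A : Finset M) (hA : A.Nonempty) (t : Torus k M) : ℙ k (A → k) :=
  Projectivization.mk k (fun u : A => (t (Multiplicative.ofAdd (u : M)) : k)) (by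
    obtain ⟨u, hu⟩ := hA
    intro h
    exact (t (Multiplicative.ofAdd u)).ne_zero (congrFun h ⟨u, hu⟩))

variable (k) in
/-- The toric variety `X_A`, the closure of the image of `φ_A`. -/
def toricVariety (A : Finset M) (hA : A.Nonempty) : Set (ℙ k (A → k)) :=
  closure (Set.range (toricMap (k := k) A hA))

/-- The action of `t ∈ T_M` on `ℙ^N`, `[x_u]_u ↦ [z^u(t) x_u]_u`. It factors through the quotient
`T_M → T_{⟨A - A⟩}`, which is surjective on closed points if `k` is algebraically closed, so that
`T_M` and `T_{⟨A - A⟩}` have the same invariant subsets. -/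
def torusAction (A : Finset M) (t : Torus k M) : ℙ k (A → k) → ℙ k (A → k) :=
  Projectivization.map
    (LinearEquiv.piCongrRight fun u : A =>
      LinearEquiv.smulOfUnit (M := k) (t (Multiplicative.ofAdd (u : M)))).toLinearMap
    (LinearEquiv.injective _)

/-- A subset of `ℙ^N` that is stable under the torus. -/
def IsTorusInvariant (A : Finset M) (Y : Set (ℙ k (A → k))) : Prop :=
  ∀ t : Torus k M, ∀ y ∈ Y, torusAction A t y ∈ Y

end Toric

end ToricGauss

end

noncomputable section

namespace ToricGauss

open MvPolynomial

/-! ### Homogeneous polynomials, Zariski closure and tangent spaces -/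

section Basic

variable {k : Type*} [Field k] {ι κ : Type*}

/-! Put `A` at height one and let `Λ` be the lattice generated by the points `(u, 1)`. Then `X_A` is
the closure of the orbit of the point `1 = [1 : ... : 1]` under the torus of `Λ`, and also the zero
locus of the binomials `x^α - x^β` with `α`, `β` of equal weight (`closure_orbit_eq`). Its dimension
is `rank Λ - 1`.

Differentiating the binomials at `1` shows that the tangent space there is `V = Hom(Λ, k)`,
restricted to `A` (`embeddedTangentSpace_unitPoint`), and the torus moves it to `t V` at `t · 1`. If
a smooth point `[v]` has tangent space `V`, then `v V ⊆ V`, because `v V` is always tangent at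
`[v]`. Hence `v` lies in the algebra of multipliers that preserve `V`. A subalgebra of `k^A`
consists of the functions constant on the blocks of a partition (`exists_partition_of_subalgebra`).
With `δ + 1` blocks, the Gauss fiber through `1` lies between the torus orbit of `1` in the linear
space of block-constant vectors and that whole `δ`-dimensional space, so it has dimension `δ`. The
torus transports this to all points with nonzero coordinates.

The indicators of the blocks are multipliers too: a linear function on `Λ`, cut off outside one
block of `A`, is again linear. Therefore every relation among the weights splits into relations
inside the blocks (`weight_blockPart_eq`). The binomial equations then decouple, and `X_A` is the
join of the orbit closures of the block indicators (`join_blockVariety`), which are disjoint because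
their supports are. -/

theorem aeval_smul_of_isHomogeneous {R : Type*} [CommRing R] [Algebra k R] {f : MvPolynomial ι k}
    {d : ℕ} (hf : f.IsHomogeneous d) (c : R) (w : ι → R) :
    aeval (fun i => c * w i) f = c ^ d * aeval w f := by
  simp only [aeval_def, eval₂_eq, Finset.mul_sum]
  refine Finset.sum_congr rfl fun m hm => ?_
  have hm' : d = ∑ i ∈ m.support, m i := hf.degree_eq_sum_deg_support hm
  rw [hm']
  simp only [mul_pow, Finset.prod_mul_distrib, Finset.prod_pow_eq_pow_sum]
  ring

theorem eval_smul_of_isHomogeneous {f : MvPolynomial ι k} {d : ℕ} (hf : f.IsHomogeneous d)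
    (c : k) (v : ι → k) : eval (c • v) f = c ^ d * eval v f := by
  have h := aeval_smul_of_isHomogeneous hf c v
  rwa [aeval_eq_eval, aeval_eq_eval] at h

theorem eval_rep_mk {f : MvPolynomial ι k} {d : ℕ} (hf : f.IsHomogeneous d)
    (v : ι → k) (hv : v ≠ 0) :
    eval (Projectivization.mk k v hv).rep f = 0 ↔ eval v f = 0 := by
  obtain ⟨c, hc⟩ := Projectivization.exists_smul_eq_mk_rep k v hv
  rw [← hc, Units.smul_def, eval_smul_of_isHomogeneous hf]
  simp

theorem isClosed_iff {Z : Set (ℙ k (ι → k))} : IsClosed Z ↔ ∃ S : Set (MvPolynomial ι k),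
    (∀ f ∈ S, ∃ d : ℕ, f.IsHomogeneous d) ∧ Z = zeroLocus S := by
  rw [← isOpen_compl_iff]
  change Zᶜᶜ ∈ _ ↔ _
  rw [compl_compl]
  rfl

theorem isClosed_eval_eq_zero {f : MvPolynomial ι k} {d : ℕ} (hf : f.IsHomogeneous d) :
    IsClosed {p : ℙ k (ι → k) | eval p.rep f = 0} :=
  isClosed_iff.2 ⟨{f}, by rintro _ rfl; exact ⟨d, hf⟩, by ext; simp [zeroLocus]⟩

theorem mem_closure_iff_eval {W : Set (ℙ k (ι → k))} {p : ℙ k (ι → k)} :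
    p ∈ closure W ↔ ∀ (f : MvPolynomial ι k) (d : ℕ), f.IsHomogeneous d →
      (∀ q ∈ W, eval q.rep f = 0) → eval p.rep f = 0 := by
  constructor
  · intro hp f d hf h
    have hW : W ⊆ {q : ℙ k (ι → k) | eval q.rep f = 0} := h
    exact closure_minimal hW (isClosed_eval_eq_zero hf) hp
  · intro h
    obtain ⟨S, hS, hW⟩ := isClosed_iff.1 (isClosed_closure (s := W))
    rw [hW]
    intro f hf
    obtain ⟨d, hd⟩ := hS f hf
    refine h f d hd fun q hq => ?_
    have := subset_closure hq
    rw [hW] at this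
    exact this f hf

theorem exists_eval_ne_zero_of_notMem {Z : Set (ℙ k (ι → k))} (hZ : IsClosed Z)
    {p : ℙ k (ι → k)} (hp : p ∉ Z) : ∃ (f : MvPolynomial ι k) (d : ℕ), f.IsHomogeneous d ∧
      (∀ q ∈ Z, eval q.rep f = 0) ∧ eval p.rep f ≠ 0 := by
  rw [← hZ.closure_eq, mem_closure_iff_eval] at hp
  push Not at hp
  exact hp

/-- The differential of `f` at `x` in the direction `w`, computed with dual numbers. -/
theorem snd_aeval_dual [Fintype ι] (f : MvPolynomial ι k) (x w : ι → k) :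
    aeval (fun i => (TrivSqZeroExt.inl (x i) + TrivSqZeroExt.inr (w i) : DualNumber k)) f =
      TrivSqZeroExt.inl (eval x f) + TrivSqZeroExt.inr (∑ i, eval x (pderiv i f) * w i) := by
  classical
  induction f using MvPolynomial.induction_on with
  | C a => simp [TrivSqZeroExt.algebraMap_eq_inl]
  | add p q hp hq =>
    simp only [map_add, hp, hq, add_mul, Finset.sum_add_distrib, TrivSqZeroExt.inl_add,
      TrivSqZeroExt.inr_add]
    abel
  | mul_X p i hp =>
    rw [map_mul, hp, aeval_X]
    ext
    · simp
    · simp only [TrivSqZeroExt.snd_mul, TrivSqZeroExt.fst_add, TrivSqZeroExt.snd_add,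
        TrivSqZeroExt.fst_inl, TrivSqZeroExt.fst_inr, TrivSqZeroExt.snd_inl,
        TrivSqZeroExt.snd_inr, Derivation.leibniz, pderiv_X, map_add, smul_eq_mul, map_mul,
        eval_X, add_mul, Finset.sum_add_distrib, MulOpposite.smul_eq_mul_unop, MulOpposite.unop_op]
      simp [Pi.single_apply, apply_ite, Finset.mul_sum, mul_comm, mul_left_comm]

theorem mem_embeddedTangentSpace_mk [Fintype ι] {X : Set (ℙ k (ι → k))} {v : ι → k} (hv : v ≠ 0)
    {w : ι → k} : w ∈ embeddedTangentSpace X (Projectivization.mk k v hv) ↔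
      ∀ (f : MvPolynomial ι k) (d : ℕ), f.IsHomogeneous d → (∀ p ∈ X, eval p.rep f = 0) →
        ∑ i, eval v (pderiv i f) * w i = 0 := by
  obtain ⟨c, hc⟩ := Projectivization.exists_smul_eq_mk_rep k v hv
  refine forall_congr' fun f => forall_congr' fun d => forall_congr' fun hf =>
    forall_congr' fun _ => ?_
  rw [← hc, Units.smul_def]
  simp_rw [eval_smul_of_isHomogeneous (hf.pderiv), mul_assoc, ← Finset.mul_sum]
  simp

/-- Precomposition of a polynomial with a linear map. -/
def linearPullback [Fintype ι] (j : (ι → k) →ₗ[k] (κ → k)) :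
    MvPolynomial κ k →ₐ[k] MvPolynomial ι k := by
  classical
  exact aeval fun c => ∑ i, C (j (Pi.single i 1) c) * X i

theorem isHomogeneous_linearPullback [Fintype ι] (j : (ι → k) →ₗ[k] (κ → k))
    {f : MvPolynomial κ k} {d : ℕ} (hf : f.IsHomogeneous d) :
    (linearPullback j f).IsHomogeneous d := by
  have := hf.aeval (n := 1) (linearPullback j ∘ X) ?_
  · rw [one_mul] at this
    convert this
    exact aeval_unique _
  · intro c
    simp only [Function.comp_apply, linearPullback, aeval_X]
    exact IsHomogeneous.sum _ _ _ fun i _ => isHomogeneous_C_mul_X _ _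

theorem linear_eq_sum [Fintype ι] [DecidableEq ι] (j : (ι → k) →ₗ[k] (κ → k)) (v : ι → k) (c : κ) :
    j v c = ∑ i, j (Pi.single i 1) c * v i := by
  conv_lhs => rw [pi_eq_sum_univ' v]
  simp only [map_sum, map_smul, Finset.sum_apply, Pi.smul_apply, smul_eq_mul]
  refine Finset.sum_congr rfl fun i _ => ?_
  rw [mul_comm]

theorem aeval_linearPullback_dual [Fintype ι] (j : (ι → k) →ₗ[k] (κ → k)) (f : MvPolynomial κ k)
    (v w : ι → k) :
    aeval (fun i => (TrivSqZeroExt.inl (v i) + TrivSqZeroExt.inr (w i) : DualNumber k))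
      (linearPullback j f) =
    aeval (fun c => (TrivSqZeroExt.inl (j v c) + TrivSqZeroExt.inr (j w c) : DualNumber k)) f := by
  classical
  rw [linearPullback, comp_aeval_apply]
  congr 2
  ext c
  · simp [linear_eq_sum j v c, TrivSqZeroExt.fst_sum, TrivSqZeroExt.algebraMap_eq_inl]
  · simp [linear_eq_sum j w c, TrivSqZeroExt.snd_sum, TrivSqZeroExt.algebraMap_eq_inl]

theorem eval_linearPullback [Fintype ι] (j : (ι → k) →ₗ[k] (κ → k)) (f : MvPolynomial κ k)
    (v : ι → k) : eval v (linearPullback j f) = eval (j v) f := by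
  classical
  simp only [← aeval_eq_eval]
  rw [linearPullback, comp_aeval_apply]
  congr 2
  ext c
  simp [linear_eq_sum j v c]

theorem sum_pderiv_linearPullback [Fintype ι] [Fintype κ] (j : (ι → k) →ₗ[k] (κ → k))
    (f : MvPolynomial κ k) (v w : ι → k) :
    ∑ i, eval v (pderiv i (linearPullback j f)) * w i =
      ∑ c, eval (j v) (pderiv c f) * j w c := by
  have h := aeval_linearPullback_dual j f v w
  rw [snd_aeval_dual, snd_aeval_dual] at h
  simpa using congrArg TrivSqZeroExt.snd h

end Basic

/-! ### Invariance under linear embeddings -/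

section Transport

variable {k : Type*} [Field k] {ι κ : Type*}
  (j : (ι → k) →ₗ[k] (κ → k)) (hj : Function.Injective j)

theorem exists_leftInverse (hj : Function.Injective j) :
    ∃ r : (κ → k) →ₗ[k] (ι → k), ∀ v, r (j v) = v := by
  obtain ⟨r, hr⟩ := j.exists_leftInverse_of_injective (LinearMap.ker_eq_bot.2 hj)
  exact ⟨r, fun v => LinearMap.congr_fun hr v⟩

theorem map_mem_span {R : Set (ℙ k (ι → k))} {q : ℙ k (ι → k)}
    (hq : q ∈ Projectivization.Subspace.span R) :
    Projectivization.map j hj q ∈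
      Projectivization.Subspace.span (Projectivization.map j hj '' R) := by
  induction hq with
  | of x hx => exact Projectivization.Subspace.subset_span _ ⟨x, hx, rfl⟩
  | mem_add v w hv hw hvw _ _ ihv ihw =>
    rw [Projectivization.map_mk] at ihv ihw ⊢
    simp only [map_add]
    exact Projectivization.Subspace.mem_add _ _ _ _ _ _ ihv ihw

theorem exists_mem_span_of_mem_span_image {R : Set (ℙ k (ι → k))} {p : ℙ k (κ → k)}
    (hp : p ∈ Projectivization.Subspace.span (Projectivization.map j hj '' R)) :
    ∃ q ∈ Projectivization.Subspace.span R, Projectivization.map j hj q = p := by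
  have lift : ∀ (q : ℙ k (ι → k)) (v : κ → k) (hv : v ≠ 0),
      Projectivization.map j hj q = Projectivization.mk k v hv →
      ∃ (v' : ι → k) (hv' : v' ≠ 0), j v' = v ∧ q = Projectivization.mk k v' hv' := by
    intro q v hv h
    induction q using Projectivization.ind with
    | h y hy =>
      rw [Projectivization.map_mk, Projectivization.mk_eq_mk_iff'] at h
      obtain ⟨c, hc⟩ := h
      have hc0 : c ≠ 0 := by
        rintro rfl
        rw [zero_smul] at hc
        exact hy (hj (by rw [← hc, map_zero]))
      refine ⟨c⁻¹ • y, smul_ne_zero (inv_ne_zero hc0) hy, ?_, ?_⟩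
      · rw [map_smul, ← hc, inv_smul_smul₀ hc0]
      · rw [Projectivization.mk_eq_mk_iff']
        exact ⟨c, smul_inv_smul₀ hc0 y⟩
  induction hp with
  | of x hx =>
    obtain ⟨y, hy, rfl⟩ := hx
    exact ⟨y, Projectivization.Subspace.subset_span _ hy, rfl⟩
  | mem_add v w hv hw hvw _ _ ihv ihw =>
    obtain ⟨q, hq, hqv⟩ := ihv
    obtain ⟨q', hq', hqw⟩ := ihw
    obtain ⟨v, hv', rfl, rfl⟩ := lift q v hv hqv
    obtain ⟨w, hw', rfl, rfl⟩ := lift q' w hw hqw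
    have hvw' : v + w ≠ 0 := fun h => hvw (by rw [← map_add, h, map_zero])
    refine ⟨_, Projectivization.Subspace.mem_add _ _ _ hv' hw' hvw' hq hq', ?_⟩
    simp [Projectivization.map_mk]

/-- With a linear retraction `r` of `j`, the image is cut out by the equations pulled back along
`r`, together with the linear equations `w = j (r w)` of the range of `j`. -/
theorem isClosedMap_map [Fintype κ] : IsClosedMap (Projectivization.map j hj) := by
  classical
  intro Z hZ
  obtain ⟨S, hS, rfl⟩ := isClosed_iff.1 hZ
  obtain ⟨r, hr⟩ := exists_leftInverse j hj
  have hl : ∀ c, (linearPullback (LinearMap.id - j ∘ₗ r)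
      (X c : MvPolynomial κ k)).IsHomogeneous 1 :=
    fun c => isHomogeneous_linearPullback _ (isHomogeneous_X k c)
  refine isClosed_iff.2 ⟨linearPullback r '' S ∪
    Set.range fun c => linearPullback (LinearMap.id - j ∘ₗ r) (X c), ?_, ?_⟩
  · rintro _ (⟨f, hf, rfl⟩ | ⟨c, rfl⟩)
    · obtain ⟨d, hd⟩ := hS f hf
      exact ⟨d, isHomogeneous_linearPullback r hd⟩
    · exact ⟨1, hl c⟩
  · apply Set.Subset.antisymm
    · rintro _ ⟨p, hp, rfl⟩
      induction p using Projectivization.ind with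
      | h v hv =>
        rw [Projectivization.map_mk]
        rintro _ (⟨f, hf, rfl⟩ | ⟨c, rfl⟩)
        · obtain ⟨d, hd⟩ := hS f hf
          rw [eval_rep_mk (isHomogeneous_linearPullback r hd), eval_linearPullback, hr,
            ← eval_rep_mk hd v hv]
          exact hp f hf
        · rw [eval_rep_mk (hl c), eval_linearPullback]
          simp [hr]
    · intro q hq
      induction q using Projectivization.ind with
      | h w hw =>
        have hjr : j (r w) = w := by
          ext c
          have := hq _ (Or.inr ⟨c, rfl⟩)
          rw [eval_rep_mk (hl c), eval_linearPullback] at this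
          simpa [sub_eq_zero, eq_comm (a := w c)] using this
        have hrw : r w ≠ 0 := fun h => hw (by rw [← hjr, h, map_zero])
        refine ⟨Projectivization.mk k (r w) hrw, fun f hf => ?_, ?_⟩
        · obtain ⟨d, hd⟩ := hS f hf
          have := hq _ (Or.inl ⟨f, hf, rfl⟩)
          rw [eval_rep_mk (isHomogeneous_linearPullback r hd), eval_linearPullback] at this
          rwa [eval_rep_mk hd]
        · rw [Projectivization.map_mk]
          simp [hjr]

variable [Fintype ι]

theorem eval_rep_map {f : MvPolynomial κ k} {d : ℕ} (hf : f.IsHomogeneous d) (p : ℙ k (ι → k)) :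
    eval (Projectivization.map j hj p).rep f = 0 ↔ eval p.rep (linearPullback j f) = 0 := by
  induction p using Projectivization.ind with
  | h v hv =>
    rw [Projectivization.map_mk, eval_rep_mk hf,
      eval_rep_mk (isHomogeneous_linearPullback j hf), eval_linearPullback]

theorem continuous_map : Continuous (Projectivization.map j hj) := by
  refine continuous_iff_isClosed.2 fun Z hZ => ?_
  obtain ⟨S, hS, rfl⟩ := isClosed_iff.1 hZ
  refine isClosed_iff.2 ⟨linearPullback j '' S, ?_, ?_⟩
  · rintro _ ⟨f, hf, rfl⟩
    obtain ⟨d, hd⟩ := hS f hf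
    exact ⟨d, isHomogeneous_linearPullback j hd⟩
  · ext p
    simp only [zeroLocus, Set.mem_preimage, Set.mem_ofPred_eq, Set.forall_mem_image]
    refine forall₂_congr fun f hf => ?_
    obtain ⟨d, hd⟩ := hS f hf
    exact eval_rep_map j hj hd p

variable [Fintype κ]

theorem isClosedEmbedding_map : Topology.IsClosedEmbedding (Projectivization.map j hj) :=
  .of_continuous_injective_isClosedMap (continuous_map j hj)
    (Projectivization.map_injective j hj) (isClosedMap_map j hj)

theorem topologicalKrullDim_image (F : Set (ℙ k (ι → k))) :
    topologicalKrullDim (Projectivization.map j hj '' F) = topologicalKrullDim F := by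
  have e := (isClosedEmbedding_map j hj).isEmbedding.homeomorphImage F
  exact (e.isHomeomorph.topologicalKrullDim_eq).symm

/-- Pullback along `j` and along a retraction `r` carries equations of either set to equations of
the other. The linear forms of `id - j ∘ r` vanish on the image and force tangent vectors into the
range of `j`. -/
theorem embeddedTangentSpace_map (X : Set (ℙ k (ι → k))) {x : ℙ k (ι → k)} (hx : x ∈ X) :
    embeddedTangentSpace (Projectivization.map j hj '' X) (Projectivization.map j hj x) =
      (embeddedTangentSpace X x).map j := by
  classical
  obtain ⟨r, hr⟩ := exists_leftInverse j hj
  induction x using Projectivization.ind with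
  | h v hv =>
    ext w
    rw [Projectivization.map_mk, mem_embeddedTangentSpace_mk, Submodule.mem_map]
    constructor
    · intro h
      refine ⟨r w, (mem_embeddedTangentSpace_mk hv).2 fun f d hf hfX => ?_, ?_⟩
      · have := h _ d (isHomogeneous_linearPullback r hf) ?_
        · rwa [sum_pderiv_linearPullback, hr] at this
        · rintro _ ⟨p, hp, rfl⟩
          have := hfX p hp
          induction p using Projectivization.ind with
          | h y hy =>
            rw [Projectivization.map_mk, eval_rep_mk (isHomogeneous_linearPullback r hf),
              eval_linearPullback, hr]
            rwa [eval_rep_mk hf] at this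
      · ext c
        have := h (linearPullback (LinearMap.id - j ∘ₗ r) (MvPolynomial.X c)) 1
          (isHomogeneous_linearPullback _ (isHomogeneous_X k c)) ?_
        · rw [sum_pderiv_linearPullback] at this
          simpa [pderiv_X, Pi.single_apply, apply_ite, sub_eq_zero, eq_comm (a := w c)] using this
        · rintro _ ⟨p, hp, rfl⟩
          induction p using Projectivization.ind with
          | h y hy =>
            rw [Projectivization.map_mk,
              eval_rep_mk (isHomogeneous_linearPullback _ (isHomogeneous_X k c)),
              eval_linearPullback]
            simp [hr]
    · rintro ⟨w, hw, rfl⟩ f d hf hfX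
      rw [← sum_pderiv_linearPullback]
      exact (mem_embeddedTangentSpace_mk hv).1 hw _ d (isHomogeneous_linearPullback j hf)
        fun p hp => (eval_rep_map j hj hf p).1 (hfX _ ⟨p, hp, rfl⟩)

theorem map_mem_smoothLocus_iff (X : Set (ℙ k (ι → k))) (x : ℙ k (ι → k)) :
    Projectivization.map j hj x ∈ smoothLocus (Projectivization.map j hj '' X) ↔
      x ∈ smoothLocus X := by
  have hinj := Projectivization.map_injective j hj
  simp only [smoothLocus, Set.mem_ofPred_eq, hinj.mem_set_image]
  refine and_congr_right fun hx => ?_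
  rw [embeddedTangentSpace_map j hj X hx, topologicalKrullDim_image,
    (Submodule.equivMapOfInjective j hj _).finrank_eq]

theorem gaussFiber_map (X : Set (ℙ k (ι → k))) {x : ℙ k (ι → k)} (hx : x ∈ X) :
    gaussFiber (Projectivization.map j hj '' X) (Projectivization.map j hj x) =
      Projectivization.map j hj '' gaussFiber X x := by
  have key : ∀ y ∈ X, (embeddedTangentSpace (Projectivization.map j hj '' X)
      (Projectivization.map j hj y) = embeddedTangentSpace (Projectivization.map j hj '' X)
      (Projectivization.map j hj x) ↔ embeddedTangentSpace X y = embeddedTangentSpace X x) := by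
    intro y hy
    rw [embeddedTangentSpace_map j hj X hx, embeddedTangentSpace_map j hj X hy]
    exact (Submodule.map_injective_of_injective hj).eq_iff
  apply Set.Subset.antisymm
  · rintro _ ⟨hy, hT⟩
    obtain ⟨y, hyX, rfl⟩ := hy.1
    exact ⟨y, ⟨(map_mem_smoothLocus_iff j hj X y).1 hy, (key y hyX).1 hT⟩, rfl⟩
  · rintro _ ⟨y, ⟨hy, hT⟩, rfl⟩
    exact ⟨(map_mem_smoothLocus_iff j hj X y).2 hy, (key y hy.1).2 hT⟩

theorem IsGaussDefect.map {X : Set (ℙ k (ι → k))} {δ : ℕ} (h : IsGaussDefect X δ) :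
    IsGaussDefect (Projectivization.map j hj '' X) δ := by
  obtain ⟨U, hU, ⟨x, hxX, hxU⟩, hδ⟩ := h
  obtain ⟨U', hU', rfl⟩ := (isClosedEmbedding_map j hj).isInducing.isOpen_iff.1 hU
  refine ⟨U', hU', ⟨_, ⟨x, hxX, rfl⟩, hxU⟩, ?_⟩
  rintro _ ⟨⟨y, hy, rfl⟩, hyU⟩
  obtain ⟨h1, h2⟩ := hδ y ⟨hy, hyU⟩
  refine ⟨(map_mem_smoothLocus_iff j hj X y).2 h1, ?_⟩
  rw [gaussFiber_map j hj X hy, topologicalKrullDim_image, h2]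

theorem join_map {m : Type*} (Y : m → Set (ℙ k (ι → k))) :
    join (fun i => Projectivization.map j hj '' Y i) = Projectivization.map j hj '' join Y := by
  rw [join, join, ← (isClosedEmbedding_map j hj).closure_image_eq]
  congr 1
  apply Set.Subset.antisymm
  · rintro p ⟨x, hx, hp⟩
    choose y hy hyx using hx
    obtain rfl : (fun i => Projectivization.map j hj (y i)) = x := funext hyx
    rw [Set.range_comp' (Projectivization.map j hj) y] at hp
    obtain ⟨q, hq, rfl⟩ := exists_mem_span_of_mem_span_image j hj hp
    exact ⟨q, ⟨y, hy, hq⟩, rfl⟩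
  · rintro _ ⟨q, ⟨y, hy, hq⟩, rfl⟩
    refine ⟨fun i => Projectivization.map j hj (y i), fun i => ⟨y i, hy i, rfl⟩, ?_⟩
    rw [Set.range_comp' (Projectivization.map j hj) y]
    exact map_mem_span j hj hq

theorem IsProjectiveVariety.map {Y : Set (ℙ k (ι → k))} (hY : IsProjectiveVariety Y) :
    IsProjectiveVariety (Projectivization.map j hj '' Y) :=
  ⟨isClosedMap_map j hj Y hY.1, hY.2.image _ (continuous_map j hj).continuousOn⟩

end Transport

/-! ### Chains of primes and algebraic independence -/

section TranscendenceDegree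

variable {k : Type*} [Field k] {P : Type*} [CommRing P] [Algebra k P]

/-- Elements that are algebraically independent modulo a prime can be enlarged by one element
modulo any strictly smaller prime. -/
theorem exists_algebraicIndependent_succ {I J : Ideal P} (hI : I.IsPrime) (hIJ : I < J) {s : ℕ}
    {x : Fin s → P} (hx : AlgebraicIndependent k fun i => Ideal.Quotient.mk J (x i)) :
    ∃ y : Fin (s + 1) → P, AlgebraicIndependent k fun i => Ideal.Quotient.mk I (y i) := by
  obtain ⟨y, hyJ, hyI⟩ := SetLike.exists_of_lt hIJ
  set g : P ⧸ I →ₐ[k] P ⧸ J := Ideal.Quotient.factorₐ k hIJ.le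
  have hg : ∀ z, g (Ideal.Quotient.mk I z) = Ideal.Quotient.mk J z := fun z => rfl
  set xI : Fin s → P ⧸ I := fun i => Ideal.Quotient.mk I (x i) with hxI
  have hgx : ∀ F : MvPolynomial (Fin s) k, g (aeval xI F) =
      aeval (fun i => Ideal.Quotient.mk J (x i)) F := by
    intro F
    rw [comp_aeval_apply]
    rfl
  have hxI' : AlgebraicIndependent k xI := by
    rw [algebraicIndependent_iff] at hx ⊢
    intro F hF
    exact hx F (by rw [← hgx, hF, map_zero])
  have hy : Transcendental (Algebra.adjoin k (Set.range xI)) (Ideal.Quotient.mk I y) := by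
    intro halg
    have hy0 : Ideal.Quotient.mk I y ∈ nonZeroDivisors (P ⧸ I) :=
      mem_nonZeroDivisors_of_ne_zero (by rwa [Ne, Ideal.Quotient.eq_zero_iff_mem])
    -- Powers of the nonzerodivisor `y` can be cancelled, so the relation may have nonzero constant
    -- coefficient. Modulo `J`, where `y` vanishes, that coefficient becomes a nontrivial relation
    -- among the `x i`.
    obtain ⟨q, hq, hq0⟩ := halg.exists_nonzero_coeff_and_aeval_eq_zero hy0
    obtain ⟨c, hc⟩ : ∃ c, Polynomial.aeval (Ideal.Quotient.mk I y) q =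
        (q.coeff 0 : P ⧸ I) + c * Ideal.Quotient.mk I y := by
      refine ⟨Polynomial.aeval (Ideal.Quotient.mk I y) q.divX, ?_⟩
      conv_lhs => rw [← q.divX_mul_X_add]
      simp [add_comm]
    obtain ⟨F, hF⟩ := (Algebra.adjoin_range_eq_range_aeval k xI).le (q.coeff 0).2
    have hF' : aeval xI F = (q.coeff 0 : P ⧸ I) := hF
    have h0 : aeval (fun i => Ideal.Quotient.mk J (x i)) F = 0 := by
      rw [← hgx, hF']
      have := congrArg g (hc.symm.trans hq0)
      rw [map_add, map_mul, hg, Ideal.Quotient.eq_zero_iff_mem.2 hyJ] at this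
      simpa using this
    have hF0 := (algebraicIndependent_iff.1 hx) F h0
    apply hq
    ext
    rw [← hF', hF0]
    simp
  have hopt := (hxI'.option_iff_transcendental _).2 hy
  refine ⟨fun i => (finSuccEquiv s i).elim y x, ?_⟩
  convert hopt.comp _ (finSuccEquiv s).injective using 1
  ext i
  rcases h : finSuccEquiv s i with _ | a <;> simp [h, hxI]

theorem exists_algebraicIndependent_of_strictMono {n : ℕ} (c : Fin (n + 1) → Ideal P)
    (hp : ∀ i, (c i).IsPrime) (hc : StrictMono c) {s : ℕ} {x : Fin s → P}
    (hx : AlgebraicIndependent k fun i => Ideal.Quotient.mk (c (Fin.last n)) (x i)) :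
    ∃ y : Fin (s + n) → P, AlgebraicIndependent k fun i => Ideal.Quotient.mk (c 0) (y i) := by
  induction n with
  | zero => exact ⟨x, hx⟩
  | succ n ih =>
    obtain ⟨y, hy⟩ := ih (fun i => c i.succ) (fun i => hp _)
      (hc.comp (Fin.strictMono_succ)) hx
    exact exists_algebraicIndependent_succ (hp 0) (hc (Fin.succ_pos 0)) hy

end TranscendenceDegree

/-! ### Ideals of affine cones and an upper bound for the dimension -/

section ConeIdeal

variable {k : Type*} [Field k] {ι : Type*}

/-- The restriction of a polynomial to the line through `v`. -/
def restrictLine (v : ι → k) : MvPolynomial ι k →ₐ[k] Polynomial k :=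
  aeval fun i => Polynomial.X * Polynomial.C (v i)

theorem restrictLine_of_isHomogeneous (v : ι → k) {f : MvPolynomial ι k} {d : ℕ}
    (hf : f.IsHomogeneous d) :
    restrictLine v f = Polynomial.X ^ d * Polynomial.C (eval v f) := by
  rw [restrictLine, aeval_smul_of_isHomogeneous hf]
  congr 1
  have := comp_aeval_apply (f := v) (Polynomial.CAlgHom (R := k) (A := k)) f
  rw [aeval_eq_eval] at this
  exact this.symm

/-- The coefficients on the line separate the homogeneous components of `f`, so membership in a cone
ideal can be tested degree by degree. -/
theorem coeff_restrictLine (v : ι → k) (f : MvPolynomial ι k) (d : ℕ) :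
    (restrictLine v f).coeff d = eval v (homogeneousComponent d f) := by
  conv_lhs => rw [← sum_homogeneousComponent f]
  simp only [map_sum, restrictLine_of_isHomogeneous v (homogeneousComponent_isHomogeneous _ f),
    Polynomial.finsetSum_coeff, Polynomial.coeff_X_pow_mul', Polynomial.coeff_C]
  rw [Finset.sum_eq_single d]
  · simp
  · intro b _ hb
    split_ifs with h1 h2 <;> [omega; rfl; rfl]
  · intro h
    rw [homogeneousComponent_eq_zero _ _ (by simpa using h)]
    simp

/-- The ideal of the affine cone over a subset of projective space. -/
def coneIdeal (Z : Set (ℙ k (ι → k))) : Ideal (MvPolynomial ι k) :=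
  ⨅ p ∈ Z, RingHom.ker (restrictLine p.rep)

theorem mem_coneIdeal {Z : Set (ℙ k (ι → k))} {f : MvPolynomial ι k} :
    f ∈ coneIdeal Z ↔ ∀ p ∈ Z, restrictLine p.rep f = 0 := by
  simp [coneIdeal, Submodule.mem_iInf, RingHom.mem_ker]

theorem mem_coneIdeal_of_isHomogeneous {Z : Set (ℙ k (ι → k))} {f : MvPolynomial ι k} {d : ℕ}
    (hf : f.IsHomogeneous d) : f ∈ coneIdeal Z ↔ ∀ p ∈ Z, eval p.rep f = 0 := by
  rw [mem_coneIdeal]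
  refine forall₂_congr fun p _ => ?_
  rw [restrictLine_of_isHomogeneous _ hf]
  simp

theorem coneIdeal_anti {Z W : Set (ℙ k (ι → k))} (h : Z ⊆ W) : coneIdeal W ≤ coneIdeal Z :=
  fun _ hf => mem_coneIdeal.2 fun p hp => mem_coneIdeal.1 hf p (h hp)

/-- A polynomial outside the ideal has a homogeneous component that is nonzero on a nonempty open
part of `Z`. Two such parts meet, and at a common point the two restrictions have nonzero product in
`k[T]`. -/
theorem isPrime_coneIdeal {Z : Set (ℙ k (ι → k))} (hZ : IsIrreducible Z) :
    (coneIdeal Z).IsPrime := by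
  refine ⟨?_, ?_⟩
  · rw [Ideal.ne_top_iff_one, mem_coneIdeal]
    intro h
    obtain ⟨p, hp⟩ := hZ.1
    simpa using h p hp
  · intro f g hfg
    by_contra! hcon
    obtain ⟨hf, hg⟩ := hcon
    simp only [mem_coneIdeal, not_forall] at hf hg
    obtain ⟨p, hp, hfp⟩ := hf
    obtain ⟨q, hq, hgq⟩ := hg
    obtain ⟨d, hd⟩ : ∃ d, (restrictLine p.rep f).coeff d ≠ 0 :=
      ⟨_, Polynomial.leadingCoeff_ne_zero.2 hfp⟩
    obtain ⟨e, he⟩ : ∃ e, (restrictLine q.rep g).coeff e ≠ 0 :=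
      ⟨_, Polynomial.leadingCoeff_ne_zero.2 hgq⟩
    rw [coeff_restrictLine] at hd he
    obtain ⟨r, hr, hrd, hre⟩ := hZ.2 _ _
      (isClosed_eval_eq_zero (homogeneousComponent_isHomogeneous d f)).isOpen_compl
      (isClosed_eval_eq_zero (homogeneousComponent_isHomogeneous e g)).isOpen_compl
      ⟨p, hp, hd⟩ ⟨q, hq, he⟩
    have h := mem_coneIdeal.1 hfg r hr
    rw [map_mul, mul_eq_zero] at h
    rcases h with h | h
    · exact hrd (by simpa [h] using (coeff_restrictLine r.rep f d).symm)
    · exact hre (by simpa [h] using (coeff_restrictLine r.rep g e).symm)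

/-- The ideal of the vertex lengthens every chain of cone ideals by one step: the cone has one
dimension more than the projective set. -/
theorem coneIdeal_lt_ker_eval_zero {Z : Set (ℙ k (ι → k))} (hZ : Z.Nonempty) :
    coneIdeal Z < RingHom.ker (eval (0 : ι → k)) := by
  obtain ⟨p, hp⟩ := hZ
  refine SetLike.lt_iff_le_and_exists.2 ⟨fun f hf => ?_, ?_⟩
  · have h := congrArg (Polynomial.coeff · 0) (mem_coneIdeal.1 hf p hp)
    simp only [coeff_restrictLine, homogeneousComponent_zero, Polynomial.coeff_zero,
      eval_C] at h
    rw [RingHom.mem_ker, eval_zero, constantCoeff_eq, h]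
  · obtain ⟨i, hi⟩ : ∃ i, p.rep i ≠ 0 := by
      by_contra! h
      exact p.rep_nonzero (funext h)
    refine ⟨X i, by simp [RingHom.mem_ker], fun h => ?_⟩
    exact hi (by simpa using (mem_coneIdeal_of_isHomogeneous (isHomogeneous_X k i)).1 h p hp)

theorem coneIdeal_lt {F : Set (ℙ k (ι → k))} {Z W : Set F} (hZ : IsClosed Z) (h : Z < W) :
    coneIdeal ((↑) '' W : Set (ℙ k (ι → k))) < coneIdeal ((↑) '' Z : Set (ℙ k (ι → k))) := by
  obtain ⟨p, hpW, hpZ⟩ := Set.exists_of_ssubset h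
  obtain ⟨C, hC, rfl⟩ := isClosed_induced_iff.1 hZ
  obtain ⟨f, d, hf, hfC, hfp⟩ := exists_eval_ne_zero_of_notMem hC hpZ
  refine SetLike.lt_iff_le_and_exists.2 ⟨coneIdeal_anti (Set.image_mono h.le), f, ?_, ?_⟩
  · rw [mem_coneIdeal_of_isHomogeneous hf]
    rintro _ ⟨q, hq, rfl⟩
    exact hfC q hq
  · rw [mem_coneIdeal_of_isHomogeneous hf]
    exact fun h => hfp (h p ⟨p, hpW, rfl⟩)

/-- If the kernel of `φ : k[x] → R` vanishes on the cone over `F`, then the dimension of `F` is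
less than the transcendence degree of `R`. -/
theorem topologicalKrullDim_le_of_ker_le {R : Type*} [CommRing R] [Algebra k R]
    (φ : MvPolynomial ι k →ₐ[k] R) {F : Set (ℙ k (ι → k))} {d : ℕ}
    (hφ : ∀ f, φ f = 0 → f ∈ coneIdeal F)
    (hR : ∀ (s : ℕ) (x : Fin s → R), AlgebraicIndependent k x → s ≤ d + 1) :
    topologicalKrullDim F ≤ ((d : ℕ∞) : WithBot ℕ∞) := by
  refine iSup_le fun l => ?_
  suffices l.length ≤ d by exact_mod_cast this
  set c : Fin (l.length + 1) → Ideal (MvPolynomial ι k) :=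
    fun i => coneIdeal ((↑) '' (l (Fin.rev i) : Set F) : Set (ℙ k (ι → k))) with hc
  have hirr : ∀ i, IsIrreducible ((↑) '' (l i : Set F) : Set (ℙ k (ι → k))) := fun i =>
    (l i).isIrreducible.image _ continuous_subtype_val.continuousOn
  have hmono : StrictMono c := by
    intro i i' h
    exact coneIdeal_lt (l _).isClosed (l.strictMono (Fin.rev_lt_rev.2 h))
  have hprime : ∀ i, (c i).IsPrime := fun i => isPrime_coneIdeal (hirr _)
  have : (RingHom.ker (eval (0 : ι → k))).IsPrime := RingHom.ker_isPrime _
  -- The step to the ideal of the vertex gives the first independent element, and the `l.length`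
  -- steps of the chain give the others. This accounts for the bound `d + 1` in `hR`.
  obtain ⟨x, hx⟩ := exists_algebraicIndependent_succ (k := k) (hprime (Fin.last _))
    (coneIdeal_lt_ker_eval_zero (hirr _).1) (s := 0) (x := Fin.elim0)
    (algebraicIndependent_empty_type)
  obtain ⟨y, hy⟩ := exists_algebraicIndependent_of_strictMono c hprime hmono hx
  have := hR _ (fun i => φ (y i)) ?_
  · omega
  · rw [algebraicIndependent_iff] at hy ⊢
    intro G hG
    apply hy
    rw [← comp_aeval_apply] at hG
    have h1 : aeval y G ∈ c 0 := coneIdeal_anti (by rintro _ ⟨q, _, rfl⟩; exact q.2) (hφ _ hG)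
    have h2 := comp_aeval_apply (f := y) (Ideal.Quotient.mkₐ k (c 0)) G
    exact h2.symm.trans (Ideal.Quotient.eq_zero_iff_mem.2 h1)

end ConeIdeal

/-! ### Regular functions on the torus -/

section GroupAlgebra

variable {k : Type*} [Field k] {Λ : Type*} [AddCommGroup Λ]

/-- Evaluation of a regular function on the torus at a closed point. -/
def torusEval (t : Torus k Λ) : AddMonoidAlgebra k Λ →ₐ[k] k :=
  AddMonoidAlgebra.lift k k Λ ((Units.coeHom k).comp t)

@[simp]
theorem torusEval_single (t : Torus k Λ) (m : Λ) (c : k) :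
    torusEval t (AddMonoidAlgebra.single m c) = c * t (Multiplicative.ofAdd m) := by
  simp [torusEval]

variable [Module.Free ℤ Λ]

/-- The witness raises `2` to a nonzero coordinate of `m`; in characteristic zero, `2` has infinite
order. -/
theorem exists_torus_apply_ne_one [CharZero k] {m : Λ} (hm : m ≠ 0) :
    ∃ t : Torus k Λ, t (Multiplicative.ofAdd m) ≠ 1 := by
  set b := Module.Free.chooseBasis ℤ Λ
  obtain ⟨i, hi⟩ : ∃ i, b.repr m i ≠ 0 := by
    by_contra! h
    exact hm (b.repr.map_eq_zero_iff.1 (Finsupp.ext h))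
  refine ⟨(zpowersHom kˣ (Units.mk0 2 two_ne_zero)).comp
    (AddMonoidHom.toMultiplicative (b.coord i).toAddMonoidHom), fun h => ?_⟩
  have h2 : (2 : k) ^ (b.repr m i) = 1 := by
    have := congrArg Units.val h
    simpa [zpowersHom_apply] using this
  have h3 : (2 : ℚ) ^ (b.repr m i) = 1 := by
    apply Rat.cast_injective (α := k)
    rw [Rat.cast_zpow, Rat.cast_ofNat, h2, Rat.cast_one]
  rw [zpow_eq_one_iff_right₀ (by norm_num) (by norm_num)] at h3
  exact hi h3

/-- A regular function on the torus is determined by its values. -/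
theorem eq_zero_of_torusEval [CharZero k] {F : AddMonoidAlgebra k Λ}
    (hF : ∀ t : Torus k Λ, torusEval t F = 0) : F = 0 := by
  -- Distinct exponents give distinct characters of the group of torus points, and these are
  -- linearly independent by Dedekind's theorem.
  let χ : Λ → (Torus k Λ →* k) := fun m =>
    (Units.coeHom k).comp (MonoidHom.eval (Multiplicative.ofAdd m))
  have hχ : Function.Injective χ := by
    intro m m' h
    by_contra hne
    obtain ⟨t, ht⟩ := exists_torus_apply_ne_one (k := k) (sub_ne_zero.2 hne)
    apply ht
    have h1 : (t (Multiplicative.ofAdd m) : k) = t (Multiplicative.ofAdd m') :=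
      DFunLike.congr_fun h t
    rw [ofAdd_sub, map_div, Units.ext h1, div_self']
  have hli := (linearIndependent_monoidHom (Torus k Λ) k).comp χ hχ
  rw [linearIndependent_iff] at hli
  rw [← AddMonoidAlgebra.coeff_eq_zero]
  apply hli
  ext t
  have := hF t
  rw [torusEval, AddMonoidAlgebra.lift_apply] at this
  rw [Finsupp.linearCombination_apply, Finsupp.sum_apply']
  simpa [χ] using this

instance isDomain_addMonoidAlgebra : IsDomain (AddMonoidAlgebra k Λ) := by
  have : TwoUniqueSums Λ :=
    TwoUniqueSums.of_injective_addHom _ (Module.Free.chooseBasis ℤ Λ).repr.injective inferInstance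
  exact NoZeroDivisors.to_isDomain _

/-- The transcendence degree of the group algebra is at most the rank of the group. -/
theorem le_finrank_of_algebraicIndependent [Module.Finite ℤ Λ] {s : ℕ}
    {x : Fin s → AddMonoidAlgebra k Λ} (hx : AlgebraicIndependent k x) :
    s ≤ Module.finrank ℤ Λ := by
  classical
  set b := Module.finBasis ℤ Λ
  set B : Set (AddMonoidAlgebra k Λ) := Set.range fun i => AddMonoidAlgebra.single (b i) 1
  have hmon : ∀ m : Λ, IsAlgebraic (Algebra.adjoin k B)
      (AddMonoidAlgebra.single m 1 : AddMonoidAlgebra k Λ) := by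
    -- The exponents whose monomials are algebraic over `k[B]` form a subgroup, which contains the
    -- basis `b`.
    let S : AddSubgroup Λ :=
      { carrier := {m | IsAlgebraic (Algebra.adjoin k B)
          (AddMonoidAlgebra.single m 1 : AddMonoidAlgebra k Λ)}
        zero_mem' := isAlgebraic_one
        add_mem' := by
          intro m m' hm hm'
          have := IsAlgebraic.mul hm hm'
          rwa [AddMonoidAlgebra.single_mul_single, mul_one] at this
        neg_mem' := by
          intro m hm
          let : Invertible (AddMonoidAlgebra.single m 1 : AddMonoidAlgebra k Λ) :=
            ⟨AddMonoidAlgebra.single (-m) 1,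
              by simp [AddMonoidAlgebra.single_mul_single, AddMonoidAlgebra.one_def],
              by simp [AddMonoidAlgebra.single_mul_single, AddMonoidAlgebra.one_def]⟩
          exact IsAlgebraic.invOf hm }
    intro m
    have hS : (AddSubgroup.toIntSubmodule S) = ⊤ := by
      rw [eq_top_iff, ← b.span_eq, Submodule.span_le]
      rintro _ ⟨i, rfl⟩
      exact isAlgebraic_algebraMap (⟨_, Algebra.subset_adjoin ⟨i, rfl⟩⟩ : Algebra.adjoin k B)
    exact (hS.symm ▸ Submodule.mem_top : m ∈ AddSubgroup.toIntSubmodule S)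
  have halg : Algebra.IsAlgebraic (Algebra.adjoin k B) (AddMonoidAlgebra k Λ) := by
    refine ⟨fun F => ?_⟩
    induction F using AddMonoidAlgebra.induction_linear with
    | zero => exact isAlgebraic_zero
    | add f g hf hg => exact hf.add hg
    | single m r =>
      have h1 : IsAlgebraic (Algebra.adjoin k B) (algebraMap k (AddMonoidAlgebra k Λ) r) :=
        isAlgebraic_algebraMap (algebraMap k (Algebra.adjoin k B) r)
      have := h1.mul (hmon m)
      rwa [← Algebra.smul_def, AddMonoidAlgebra.smul_single, smul_eq_mul, mul_one] at this
  have h1 := hx.lift_cardinalMk_le_trdeg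
  have h2 := Algebra.IsAlgebraic.trdeg_le_cardinalMk k B
  have h3 : Cardinal.mk B ≤ Module.finrank ℤ Λ := by
    have := Cardinal.mk_range_le_lift (f := fun i => (AddMonoidAlgebra.single (b i) 1 :
      AddMonoidAlgebra k Λ))
    simpa using this
  have h4 := (Cardinal.lift_le.2 (h2.trans h3))
  have h5 := h1.trans h4
  simpa using h5

end GroupAlgebra

/-! ### Torus orbits in projective space -/

section Orbits

variable {k : Type*} [Field k] {Λ Γ : Type*} [AddCommGroup Λ] [AddCommGroup Γ] {ι : Type*}

/-- The diagonal linear map by which a point of the torus acts with weights `a`. -/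
def torusScale (a : ι → Λ) (t : Torus k Λ) : (ι → k) ≃ₗ[k] (ι → k) :=
  LinearEquiv.piCongrRight fun u => LinearEquiv.smulOfUnit (M := k) (t (Multiplicative.ofAdd (a u)))

@[simp]
theorem torusScale_apply (a : ι → Λ) (t : Torus k Λ) (v : ι → k) (u : ι) :
    torusScale a t v u = t (Multiplicative.ofAdd (a u)) * v u := rfl

/-- The action of the torus on projective space with weights `a`. -/
def torusMove (a : ι → Λ) (t : Torus k Λ) : ℙ k (ι → k) → ℙ k (ι → k) :=
  Projectivization.map (torusScale a t).toLinearMap (torusScale a t).injective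

theorem torusMove_mk (a : ι → Λ) (t : Torus k Λ) (v : ι → k) (hv : v ≠ 0) :
    torusMove a t (Projectivization.mk k v hv) = Projectivization.mk k (torusScale a t v)
      ((torusScale a t).map_ne_zero_iff.2 hv) := rfl

theorem torusMove_mul (a : ι → Λ) (s t : Torus k Λ) (p : ℙ k (ι → k)) :
    torusMove a (s * t) p = torusMove a s (torusMove a t p) := by
  induction p using Projectivization.ind with
  | h v hv =>
    simp only [torusMove_mk]
    congr 1
    ext u
    simp [mul_assoc]

@[simp]
theorem torusMove_one (a : ι → Λ) (p : ℙ k (ι → k)) : torusMove a 1 p = p := by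
  induction p using Projectivization.ind with
  | h v hv =>
    simp only [torusMove_mk]
    congr 1
    ext u
    simp

/-- The torus orbit of a point. -/
def orbit (a : ι → Λ) (p : ℙ k (ι → k)) : Set (ℙ k (ι → k)) :=
  Set.range fun t : Torus k Λ => torusMove a t p

theorem mem_orbit_self (a : ι → Λ) (p : ℙ k (ι → k)) : p ∈ orbit a p := ⟨1, torusMove_one a p⟩

theorem torusMove_mem_orbit {a : ι → Λ} {p q : ℙ k (ι → k)} (t : Torus k Λ) (hq : q ∈ orbit a p) :
    torusMove a t q ∈ orbit a p := by
  obtain ⟨s, rfl⟩ := hq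
  exact ⟨t * s, torusMove_mul a t s p⟩

/-- Pullback of polynomials along the orbit map `t ↦ (t ^ (a u) * c u)`. -/
def orbitPullback (a : ι → Λ) (c : ι → k) : MvPolynomial ι k →ₐ[k] AddMonoidAlgebra k Λ :=
  aeval fun u => AddMonoidAlgebra.single (a u) (c u)

theorem torusEval_orbitPullback (a : ι → Λ) (c : ι → k) (t : Torus k Λ) (f : MvPolynomial ι k) :
    torusEval t (orbitPullback a c f) = eval (torusScale a t c) f := by
  rw [orbitPullback, comp_aeval_apply, ← aeval_eq_eval]
  congr 2
  ext u
  simp [mul_comm]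

/-- Each nonempty open part of the orbit contains the image of the nonvanishing locus of some
nonzero element of `k[Λ]`. This ring is a domain, so the product of two such elements is nonzero at
some torus point. -/
theorem isIrreducible_orbit [CharZero k] [Module.Free ℤ Λ] (a : ι → Λ) (p : ℙ k (ι → k)) :
    IsIrreducible (orbit a p) := by
  refine ⟨⟨p, mem_orbit_self a p⟩, ?_⟩
  induction p using Projectivization.ind with
  | h c hc =>
    have key : ∀ (U : Set (ℙ k (ι → k))), IsOpen U →
        (orbit a (Projectivization.mk k c hc) ∩ U).Nonempty →
        ∃ (f : MvPolynomial ι k), orbitPullback a c f ≠ 0 ∧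
          ∀ t : Torus k Λ, torusEval t (orbitPullback a c f) ≠ 0 →
            torusMove a t (Projectivization.mk k c hc) ∈ U := by
      rintro U hU ⟨_, ⟨t, rfl⟩, ht⟩
      obtain ⟨f, d, hf, hfU, hft⟩ :=
        exists_eval_ne_zero_of_notMem (isClosed_compl_iff.2 hU) (fun h => h ht)
      refine ⟨f, fun h => hft ?_, fun s hs => ?_⟩
      · simp only [torusMove_mk]
        rw [eval_rep_mk hf, ← torusEval_orbitPullback, h, map_zero]
      · by_contra hcon
        apply hs
        have := hfU _ hcon
        rwa [torusMove_mk, eval_rep_mk hf, ← torusEval_orbitPullback] at this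
    intro U V hU hV hpU hpV
    obtain ⟨f, hf, hfU⟩ := key U hU hpU
    obtain ⟨g, hg, hgV⟩ := key V hV hpV
    obtain ⟨t, ht⟩ : ∃ t : Torus k Λ,
        torusEval t (orbitPullback a c f * orbitPullback a c g) ≠ 0 := by
      by_contra! h
      exact mul_ne_zero hf hg (eq_zero_of_torusEval h)
    rw [map_mul, mul_ne_zero_iff] at ht
    exact ⟨_, ⟨t, rfl⟩, hfU t ht.1, hgV t ht.2⟩

theorem torusMove_mem_closure_orbit [Fintype ι] {a : ι → Λ} {p q : ℙ k (ι → k)} (t : Torus k Λ)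
    (hq : q ∈ closure (orbit a p)) : torusMove a t q ∈ closure (orbit a p) :=
  map_mem_closure (continuous_map _ _) hq fun _ h => torusMove_mem_orbit t h

variable [Nonempty ι]

variable (k ι) in
/-- The point all of whose coordinates are `1`. -/
def unitPoint : ℙ k (ι → k) := Projectivization.mk k (1 : ι → k) one_ne_zero

theorem orbitPullback_eq_zero [CharZero k] [Module.Free ℤ Λ] {a : ι → Λ} {f : MvPolynomial ι k}
    {d : ℕ} (hf : f.IsHomogeneous d) (hfa : ∀ q ∈ orbit a (unitPoint k ι), eval q.rep f = 0) :
    orbitPullback a 1 f = 0 := by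
  refine eq_zero_of_torusEval fun t => ?_
  rw [torusEval_orbitPullback]
  have := hfa _ ⟨t, rfl⟩
  simpa only [unitPoint, torusMove_mk, eval_rep_mk hf] using this

end Orbits

/-! ### Binomial equations of toric varieties -/

section Binomials

variable {k : Type*} [Field k] {Λ : Type*} [AddCommGroup Λ] {ι : Type*} [Fintype ι]

/-- The weight of the monomial with exponent `α`. -/
def weight (a : ι → Λ) (α : ι →₀ ℕ) : Λ := ∑ u, α u • a u

/-- The point `w` satisfies the binomial equations of the toric variety with weights `a`. -/
def SatisfiesBinomials (a : ι → Λ) {R : Type*} [CommRing R] (w : ι → R) : Prop :=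
  ∀ α β : ι →₀ ℕ, weight a α = weight a β → ∏ u, w u ^ α u = ∏ u, w u ^ β u

theorem prod_torus_pow (a : ι → Λ) (t : Torus k Λ) (α : ι →₀ ℕ) :
    ∏ u, (t (Multiplicative.ofAdd (a u)) : k) ^ α u = t (Multiplicative.ofAdd (weight a α)) := by
  simp [weight, ofAdd_sum, ofAdd_nsmul]

theorem map_weight (h : Λ →ₗ[ℤ] ℤ) {a : ι → Λ} (ha : ∀ u, h (a u) = 1) (α : ι →₀ ℕ) :
    h (weight a α) = ((∑ u, α u : ℕ) : ℤ) := by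
  simp [weight, ha]

/-- The height `h` reads the degree of a monomial off its weight. Hence the binomials are
homogeneous, and their vanishing does not depend on a representative. -/
theorem sum_eq_of_weight_eq (h : Λ →ₗ[ℤ] ℤ) {a : ι → Λ} (ha : ∀ u, h (a u) = 1) {α β : ι →₀ ℕ}
    (hαβ : weight a α = weight a β) : ∑ u, α u = ∑ u, β u := by
  have := congrArg h hαβ
  rw [map_weight h ha, map_weight h ha] at this
  exact_mod_cast this

theorem SatisfiesBinomials.mul_left (h : Λ →ₗ[ℤ] ℤ) {a : ι → Λ} (ha : ∀ u, h (a u) = 1)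
    {R : Type*} [CommRing R] {w : ι → R} (hw : SatisfiesBinomials a w) (c : R) :
    SatisfiesBinomials a fun u => c * w u := by
  intro α β hαβ
  simp only [mul_pow, Finset.prod_mul_distrib, Finset.prod_pow_eq_pow_sum, hw α β hαβ,
    sum_eq_of_weight_eq h ha hαβ]

/-- The common zeros of the binomials of the toric variety with weights `a`. -/
def binomialLocus (k : Type*) [Field k] (a : ι → Λ) : Set (ℙ k (ι → k)) :=
  {p | SatisfiesBinomials a p.rep}

theorem mk_mem_binomialLocus (h : Λ →ₗ[ℤ] ℤ) {a : ι → Λ} (ha : ∀ u, h (a u) = 1) {v : ι → k}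
    (hv : v ≠ 0) :
    Projectivization.mk k v hv ∈ binomialLocus k a ↔ SatisfiesBinomials a v := by
  obtain ⟨c, hc⟩ := Projectivization.exists_smul_eq_mk_rep k v hv
  rw [binomialLocus, Set.mem_ofPred_eq, ← hc]
  constructor
  · intro hs
    simpa [Units.smul_def] using hs.mul_left h ha (c⁻¹ : kˣ)
  · intro hs
    exact hs.mul_left h ha (c : k)

theorem satisfiesBinomials_torusScale {a : ι → Λ} (t : Torus k Λ) {v : ι → k}
    (hv : SatisfiesBinomials a v) : SatisfiesBinomials a (torusScale a t v) := by
  intro α β hαβ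
  simp only [torusScale_apply, mul_pow, Finset.prod_mul_distrib, prod_torus_pow, hαβ, hv α β hαβ]

theorem torusMove_mem_binomialLocus (h : Λ →ₗ[ℤ] ℤ) {a : ι → Λ} (ha : ∀ u, h (a u) = 1)
    (t : Torus k Λ) {p : ℙ k (ι → k)} (hp : p ∈ binomialLocus k a) :
    torusMove a t p ∈ binomialLocus k a := by
  induction p using Projectivization.ind with
  | h v hv =>
    rw [torusMove_mk, mk_mem_binomialLocus h ha]
    exact satisfiesBinomials_torusScale t ((mk_mem_binomialLocus h ha hv).1 hp)

theorem eval_binomial (v : ι → k) (α β : ι →₀ ℕ) :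
    eval v (monomial α 1 - monomial β 1) = ∏ u, v u ^ α u - ∏ u, v u ^ β u := by
  simp [eval_monomial, Finsupp.prod_fintype]

theorem isHomogeneous_binomial {α β : ι →₀ ℕ} (h : ∑ u, α u = ∑ u, β u) :
    (monomial α 1 - monomial β 1 : MvPolynomial ι k).IsHomogeneous (∑ u, α u) := by
  refine (isHomogeneous_monomial _ ?_).sub (isHomogeneous_monomial _ ?_)
  · exact Finsupp.degree_eq_sum α
  · rw [h]; exact Finsupp.degree_eq_sum β

theorem isClosed_binomialLocus (h : Λ →ₗ[ℤ] ℤ) {a : ι → Λ} (ha : ∀ u, h (a u) = 1) :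
    IsClosed (binomialLocus k a) := by
  have : binomialLocus k a = ⋂ (α : ι →₀ ℕ) (β : ι →₀ ℕ) (_ : weight a α = weight a β),
      {p : ℙ k (ι → k) | eval p.rep (monomial α 1 - monomial β 1) = 0} := by
    ext p
    simp only [binomialLocus, SatisfiesBinomials, Set.mem_iInter, Set.mem_ofPred_eq,
      eval_binomial, sub_eq_zero]
  rw [this]
  exact isClosed_iInter fun α => isClosed_iInter fun β => isClosed_iInter fun hαβ =>
    isClosed_eval_eq_zero (isHomogeneous_binomial (sum_eq_of_weight_eq h ha hαβ))

theorem orbitPullback_monomial (a : ι → Λ) (α : ι →₀ ℕ) (r : k) :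
    orbitPullback a 1 (monomial α r) = AddMonoidAlgebra.single (weight a α) r := by
  rw [orbitPullback, aeval_monomial, Finsupp.prod_fintype _ _ (by simp)]
  simp only [Pi.one_apply, AddMonoidAlgebra.single_pow, one_pow]
  have : ∀ s : Finset ι, ∏ u ∈ s, (AddMonoidAlgebra.single (α u • a u) 1 : AddMonoidAlgebra k Λ) =
      AddMonoidAlgebra.single (∑ u ∈ s, α u • a u) 1 := by
    classical
    intro s
    induction s using Finset.induction_on with
    | empty => simp [AddMonoidAlgebra.one_def]
    | insert u s hu ih =>
      rw [Finset.prod_insert hu, ih, AddMonoidAlgebra.single_mul_single, Finset.sum_insert hu,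
        one_mul]
  rw [this, ← Algebra.smul_def, AddMonoidAlgebra.smul_single, smul_eq_mul, mul_one, weight]

/-- The toric ideal is spanned by binomials, so that it vanishes where the binomials do. -/
theorem SatisfiesBinomials.aeval_eq_zero {R : Type*} [CommRing R] [Algebra k R] {a : ι → Λ}
    {w : ι → R} (hw : SatisfiesBinomials a w) {f : MvPolynomial ι k}
    (hf : orbitPullback a 1 f = 0) : aeval w f = 0 := by
  classical
  -- `c m` is the common value at `w` of all monomials of weight `m`. The default `0` belongs to
  -- weights of no monomial and plays no role. Thus evaluation at `w` factors linearly through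
  -- `k[Λ]`.
  let c : Λ → R := fun m => if h : ∃ α, weight a α = m then ∏ u, w u ^ h.choose u else 0
  have hc : ∀ α, c (weight a α) = ∏ u, w u ^ α u := by
    intro α
    have hex : ∃ β, weight a β = weight a α := ⟨α, rfl⟩
    simp only [c, dif_pos hex]
    exact hw _ _ hex.choose_spec
  let ψ : AddMonoidAlgebra k Λ →ₗ[k] R :=
    Finsupp.linearCombination k c ∘ₗ (AddMonoidAlgebra.coeffLinearEquiv k).toLinearMap
  have hψ : ψ ∘ₗ (orbitPullback a 1).toLinearMap =
      (aeval w : MvPolynomial ι k →ₐ[k] R).toLinearMap := by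
    refine (MvPolynomial.basisMonomials ι k).ext fun α => ?_
    simp only [coe_basisMonomials, LinearMap.comp_apply, AlgHom.toLinearMap_apply,
      orbitPullback_monomial]
    rw [aeval_monomial, Finsupp.prod_fintype _ _ (by simp), ← hc]
    change Finsupp.linearCombination k c (Finsupp.single (weight a α) 1) = _
    simp
  have := LinearMap.congr_fun hψ f
  simp only [LinearMap.comp_apply, AlgHom.toLinearMap_apply, hf, map_zero] at this
  exact this.symm

theorem topologicalKrullDim_le_of_subset_binomialLocus [Module.Free ℤ Λ]
    [Module.Finite ℤ Λ] (h : Λ →ₗ[ℤ] ℤ) {a : ι → Λ} (ha : ∀ u, h (a u) = 1) {d : ℕ}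
    (hd : Module.finrank ℤ Λ = d + 1) {F : Set (ℙ k (ι → k))} (hF : F ⊆ binomialLocus k a) :
    topologicalKrullDim F ≤ ((d : ℕ∞) : WithBot ℕ∞) := by
  refine topologicalKrullDim_le_of_ker_le (orbitPullback a 1) (fun f hf => ?_)
    (fun s x hx => hd ▸ le_finrank_of_algebraicIndependent hx)
  rw [mem_coneIdeal]
  intro p hp
  -- The line through `p` is a solution of the binomials with coordinates in `k[T]`: the solution
  -- `p`, multiplied by `T`.
  refine SatisfiesBinomials.aeval_eq_zero (SatisfiesBinomials.mul_left h ha ?_ _) hf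
  intro α β hαβ
  simp only [← map_pow, ← map_prod, hF hp α β hαβ]

variable [Nonempty ι]

theorem unitPoint_mem_binomialLocus (h : Λ →ₗ[ℤ] ℤ) {a : ι → Λ} (ha : ∀ u, h (a u) = 1) :
    unitPoint k ι ∈ binomialLocus k a :=
  (mk_mem_binomialLocus h ha _).2 fun _ _ _ => by simp

theorem orbit_subset_binomialLocus (h : Λ →ₗ[ℤ] ℤ) {a : ι → Λ} (ha : ∀ u, h (a u) = 1) :
    orbit a (unitPoint k ι) ⊆ binomialLocus k a := by
  rintro _ ⟨t, rfl⟩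
  exact torusMove_mem_binomialLocus h ha t (unitPoint_mem_binomialLocus h ha)

/-- A homogeneous equation of the orbit pulls back to an element of `k[Λ]` with all torus values
zero, hence to `0`. Such a polynomial vanishes at every solution of the binomials. -/
theorem closure_orbit_eq [CharZero k] [Module.Free ℤ Λ] (h : Λ →ₗ[ℤ] ℤ) {a : ι → Λ}
    (ha : ∀ u, h (a u) = 1) : closure (orbit a (unitPoint k ι)) = binomialLocus k a := by
  apply Set.Subset.antisymm
  · exact closure_minimal (orbit_subset_binomialLocus h ha) (isClosed_binomialLocus h ha)
  · intro p hp
    rw [mem_closure_iff_eval]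
    intro f d hf hfa
    have := SatisfiesBinomials.aeval_eq_zero hp (orbitPullback_eq_zero hf hfa)
    rwa [aeval_eq_eval] at this

end Binomials

/-! ### Chains of subtorus orbits and a lower bound for the dimension -/

theorem isIrreducible_preimage_val {T : Type*} [TopologicalSpace T] {F W : Set T} (hW : W ⊆ F)
    (hirr : IsIrreducible W) : IsIrreducible ((↑) ⁻¹' W : Set F) := by
  refine ⟨?_, ?_⟩
  · obtain ⟨x, hx⟩ := hirr.1
    exact ⟨⟨x, hW hx⟩, hx⟩
  · rintro _ _ hU hV ⟨x, hx, hxU⟩ ⟨y, hy, hyV⟩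
    obtain ⟨U, hU', rfl⟩ := isOpen_induced_iff.1 hU
    obtain ⟨V, hV', rfl⟩ := isOpen_induced_iff.1 hV
    obtain ⟨z, hz, hzU, hzV⟩ := hirr.2 U V hU' hV' ⟨x, hx, hxU⟩ ⟨y, hy, hyV⟩
    exact ⟨⟨z, hW hz⟩, hz, hzU, hzV⟩

/-- The `W i` need not be closed. Their closures in `F` form the chain, and the sets `C` keep them
distinct. -/
theorem le_topologicalKrullDim_of_chain {T : Type*} [TopologicalSpace T] {F : Set T} {d : ℕ}
    (W : Fin (d + 1) → Set T) (hWF : ∀ i, W i ⊆ F) (hirr : ∀ i, IsIrreducible (W i))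
    (hmono : ∀ i : Fin d, W i.castSucc ⊆ W i.succ)
    (hsep : ∀ i : Fin d, ∃ C, IsClosed C ∧ W i.castSucc ⊆ C ∧ ¬ W i.succ ⊆ C) :
    ((d : ℕ∞) : WithBot ℕ∞) ≤ topologicalKrullDim F := by
  let Z : Fin (d + 1) → TopologicalSpace.IrreducibleCloseds F := fun i =>
    ⟨closure ((↑) ⁻¹' W i), (isIrreducible_preimage_val (hWF i) (hirr i)).closure,
      isClosed_closure⟩
  let l : LTSeries (TopologicalSpace.IrreducibleCloseds F) :=
    { length := d
      toFun := Z
      step := by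
        intro i
        change (Z i.castSucc : Set F) ⊂ (Z i.succ : Set F)
        obtain ⟨C, hC, hCi, hCi'⟩ := hsep i
        refine ⟨closure_mono (Set.preimage_mono (hmono i)), fun hle => hCi' fun x hx => ?_⟩
        have h1 : (Z i.castSucc : Set F) ⊆ (↑) ⁻¹' C :=
          closure_minimal (Set.preimage_mono hCi) (hC.preimage continuous_subtype_val)
        exact h1 (hle (subset_closure (show (⟨x, hWF _ hx⟩ : F) ∈ _ from hx))) }
  exact Order.LTSeries.length_le_krullDim l

section LowerBound

variable {k : Type*} [Field k] {Λ : Type*} [AddCommGroup Λ] {ι : Type*} [Fintype ι]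

theorem exists_weight_sub_eq {a : ι → Λ} (hspan : Submodule.span ℤ (Set.range a) = ⊤) (m : Λ) :
    ∃ α β : ι →₀ ℕ, weight a α - weight a β = m := by
  have hm : m ∈ Submodule.span ℤ (Set.range a) := hspan ▸ Submodule.mem_top
  obtain ⟨c, rfl⟩ := (Submodule.mem_span_range_iff_exists_fun ℤ).1 hm
  refine ⟨Finsupp.equivFunOnFinite.symm fun u => (c u).toNat,
    Finsupp.equivFunOnFinite.symm fun u => (-c u).toNat, ?_⟩
  simp only [weight, Finsupp.equivFunOnFinite_symm_apply_apply, ← Finset.sum_sub_distrib]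
  refine Finset.sum_congr rfl fun u _ => ?_
  rw [← natCast_zsmul, ← natCast_zsmul, ← sub_smul, Int.toNat_sub_toNat_neg]

theorem finrank_ker_add_one [Module.Free ℤ Λ] [Module.Finite ℤ Λ] (h : Λ →ₗ[ℤ] ℤ) {m : Λ}
    (hm : h m = 1) : Module.finrank ℤ (LinearMap.ker h) + 1 = Module.finrank ℤ Λ := by
  have hsurj : Function.Surjective h := fun n => ⟨n • m, by simp [hm]⟩
  have h1 := (LinearMap.ker h).finrank_quotient_add_finrank
  have h2 := (h.quotKerEquivOfSurjective hsurj).finrank_eq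
  rw [Module.finrank_self] at h2
  omega

/-- Projecting `Λ` onto the span of the first `i` basis vectors of `ker h` gives a subtorus of
dimension `i`. The orbits of the unit point under these subtori, for `i = 0, ..., d`, form the
chain. -/
theorem le_topologicalKrullDim_of_orbit_subset [CharZero k] [Module.Free ℤ Λ] [Module.Finite ℤ Λ]
    [Nonempty ι] (h : Λ →ₗ[ℤ] ℤ) {a : ι → Λ} (ha : ∀ u, h (a u) = 1)
    (hspan : Submodule.span ℤ (Set.range a) = ⊤) {d : ℕ} (hd : Module.finrank ℤ Λ = d + 1)
    {F : Set (ℙ k (ι → k))} (hF : orbit a (unitPoint k ι) ⊆ F) :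
    ((d : ℕ∞) : WithBot ℕ∞) ≤ topologicalKrullDim F := by
  have hK : Module.finrank ℤ (LinearMap.ker h) = d := by
    have := finrank_ker_add_one h (ha (Classical.arbitrary ι))
    omega
  let b := Module.finBasisOfFinrankEq ℤ (LinearMap.ker h) hK
  let a₀ := a (Classical.arbitrary ι)
  let q : Λ →ₗ[ℤ] LinearMap.ker h :=
    (LinearMap.id - h.smulRight a₀).codRestrict _ fun m => by simp [a₀, ha]
  have hq : ∀ m : LinearMap.ker h, q m = m := by
    intro m
    have hm : h m = 0 := m.2
    ext
    change (m : Λ) - h m • a₀ = m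
    rw [hm, zero_smul, sub_zero]
  let P : ℕ → (LinearMap.ker h →ₗ[ℤ] LinearMap.ker h) := fun i =>
    b.constr ℤ fun j => if (j : ℕ) < i then b j else 0
  have hPb : ∀ i j, P i (b j) = if (j : ℕ) < i then b j else 0 := fun i j =>
    b.constr_basis ℤ _ j
  have hPP : ∀ i, P i ∘ₗ P (i + 1) = P i := by
    intro i
    refine b.ext fun j => ?_
    simp only [LinearMap.comp_apply, hPb]
    split_ifs with h1 h2
    · simp [hPb, h2]
    · simp [hPb, h2]
    · omega
    · simp
  let E : ℕ → (Λ →ₗ[ℤ] Λ) := fun i => (LinearMap.ker h).subtype ∘ₗ P i ∘ₗ q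
  have hEE : ∀ i m, E i (E (i + 1) m) = E i m := by
    intro i m
    simp only [E, LinearMap.comp_apply, Submodule.subtype_apply, hq]
    rw [← LinearMap.comp_apply (P i), hPP]
  have hEb : ∀ i (j : Fin d), E i (b j : Λ) = if (j : ℕ) < i then (b j : Λ) else 0 := by
    intro i j
    simp only [E, LinearMap.comp_apply, Submodule.subtype_apply, hq, hPb]
    split_ifs <;> simp
  let pull : ℕ → Torus k Λ → Torus k Λ := fun i t =>
    t.comp (AddMonoidHom.toMultiplicative (E i).toAddMonoidHom)
  have hpull : ∀ i t m, pull i t (Multiplicative.ofAdd m) = t (Multiplicative.ofAdd (E i m)) :=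
    fun i t m => rfl
  have hmove : ∀ i t, torusMove (fun u => E i (a u)) t (unitPoint k ι) =
      torusMove a (pull i t) (unitPoint k ι) := fun i t => rfl
  refine le_topologicalKrullDim_of_chain
    (fun i => orbit (fun u => E i (a u)) (unitPoint k ι)) ?_ ?_ ?_ ?_
  · rintro i _ ⟨t, rfl⟩
    exact hF ⟨pull i t, rfl⟩
  · exact fun i => isIrreducible_orbit _ _
  · rintro i _ ⟨t, rfl⟩
    refine ⟨pull i t, ?_⟩
    simp only [hmove]
    congr 1
    refine MonoidHom.ext fun m => congrArg (fun m => t (Multiplicative.ofAdd m)) ?_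
    exact hEE i m.toAdd
  · intro i
    -- As `b i` has height zero, it is the difference of the weights of two monomials of equal
    -- degree. Their binomial vanishes on the `i`-th orbit, since `E i` kills `b i`, but not on the
    -- next, since `E (i + 1)` fixes it.
    obtain ⟨α, β, hαβ⟩ := exists_weight_sub_eq hspan (b i : Λ)
    have hdeg : ∑ u, α u = ∑ u, β u := by
      have h0 : h (b i : Λ) = 0 := (b i).2
      rw [← hαβ, map_sub, map_weight h ha, map_weight h ha, sub_eq_zero] at h0
      exact_mod_cast h0
    have hhom := isHomogeneous_binomial (k := k) hdeg
    have heval : ∀ n t, eval (torusMove (fun u => E n (a u)) t (unitPoint k ι)).rep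
        (monomial α 1 - monomial β 1) = 0 ↔ t (Multiplicative.ofAdd (E n (b i))) = 1 := by
      intro n t
      rw [hmove, unitPoint, torusMove_mk, eval_rep_mk hhom, eval_binomial]
      simp only [torusScale_apply, Pi.one_apply, mul_one, prod_torus_pow a (pull n t)]
      rw [hpull, hpull, sub_eq_zero, Units.val_inj, ← hαβ, map_sub, ofAdd_sub, map_div, div_eq_one]
    refine ⟨_, isClosed_eval_eq_zero hhom, ?_, ?_⟩
    · rintro _ ⟨t, rfl⟩
      refine (heval _ t).2 ?_
      simp [hEb]
    · intro hsub
      have hb0 : (b i : Λ) ≠ 0 := fun h0 => b.ne_zero i (Subtype.ext h0)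
      obtain ⟨t, ht⟩ := exists_torus_apply_ne_one (k := k) hb0
      apply ht
      have := (heval _ t).1 (hsub ⟨t, rfl⟩)
      simpa [hEb] using this

theorem topologicalKrullDim_eq_of_orbit_subset [CharZero k] [Module.Free ℤ Λ] [Module.Finite ℤ Λ]
    [Nonempty ι] (h : Λ →ₗ[ℤ] ℤ) {a : ι → Λ} (ha : ∀ u, h (a u) = 1)
    (hspan : Submodule.span ℤ (Set.range a) = ⊤) {d : ℕ} (hd : Module.finrank ℤ Λ = d + 1)
    {F : Set (ℙ k (ι → k))} (hF : orbit a (unitPoint k ι) ⊆ F) (hF' : F ⊆ binomialLocus k a) :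
    topologicalKrullDim F = ((d : ℕ∞) : WithBot ℕ∞) :=
  le_antisymm (topologicalKrullDim_le_of_subset_binomialLocus h ha hd hF')
    (le_topologicalKrullDim_of_orbit_subset h ha hspan hd hF)

end LowerBound

/-! ### Tangent spaces of toric varieties -/

section Tangent

variable {k : Type*} [Field k] {Λ : Type*} [AddCommGroup Λ] {ι : Type*}

/-- Restriction of linear functions to the points `a`. -/
def weightMap (k : Type*) [Field k] (a : ι → Λ) : (Λ →ₗ[ℤ] k) →ₗ[k] (ι → k) where
  toFun l u := l (a u)
  map_add' _ _ := rfl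
  map_smul' _ _ := rfl

@[simp]
theorem weightMap_apply (a : ι → Λ) (l : Λ →ₗ[ℤ] k) (u : ι) : weightMap k a l u = l (a u) := rfl

theorem finrank_range_weightMap [Module.Free ℤ Λ] [Module.Finite ℤ Λ] {a : ι → Λ}
    (hspan : Submodule.span ℤ (Set.range a) = ⊤) :
    Module.finrank k (LinearMap.range (weightMap k a)) = Module.finrank ℤ Λ := by
  have hinj : Function.Injective (weightMap k a) := by
    intro l l' h
    apply LinearMap.ext_on hspan
    rintro _ ⟨u, rfl⟩
    exact congrFun h u
  rw [LinearMap.finrank_range_of_inj hinj]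
  have e := (Module.finBasis ℤ Λ).constr (M' := k) k
  rw [← e.finrank_eq]
  simp

theorem eq_of_forall_linearMap_eq [CharZero k] [Module.Free ℤ Λ] {m m' : Λ}
    (h : ∀ l : Λ →ₗ[ℤ] k, l m = l m') : m = m' := by
  set b := Module.Free.chooseBasis ℤ Λ
  apply b.repr.injective
  ext i
  have := h ((Algebra.linearMap ℤ k) ∘ₗ b.coord i)
  simpa using this

variable [Fintype ι]

theorem weight_add (a : ι → Λ) (α β : ι →₀ ℕ) :
    weight a (α + β) = weight a α + weight a β := by
  simp [weight, add_smul, Finset.sum_add_distrib]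

/-- A family that satisfies the relations among the generators `a` extends to a homomorphism. -/
theorem exists_hom_of_weight_eq {a : ι → Λ} (hspan : Submodule.span ℤ (Set.range a) = ⊤)
    {H : Type*} [AddCommGroup H] (w : ι → H)
    (hw : ∀ α β : ι →₀ ℕ, weight a α = weight a β → weight w α = weight w β) :
    ∃ l : Λ →+ H, ∀ u, l (a u) = w u := by
  classical
  choose α β hαβ using exists_weight_sub_eq hspan
  have key : ∀ (γ δ : ι →₀ ℕ) (m : Λ), weight a γ - weight a δ = m →
      weight w (α m) - weight w (β m) = weight w γ - weight w δ := by
    intro γ δ m hm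
    rw [sub_eq_sub_iff_add_eq_add, ← weight_add, ← weight_add]
    apply hw
    rw [weight_add, weight_add, ← sub_eq_sub_iff_add_eq_add, hαβ, hm]
  refine ⟨AddMonoidHom.mk' (fun m => weight w (α m) - weight w (β m)) fun m m' => ?_, fun u => ?_⟩
  · rw [key (α m + α m') (β m + β m') (m + m'), weight_add, weight_add]
    · abel
    · rw [weight_add, weight_add, add_sub_add_comm, hαβ, hαβ]
  · change weight w (α (a u)) - weight w (β (a u)) = w u
    rw [key (Finsupp.single u 1) 0 (a u)] <;>
    simp [weight, Finsupp.single_apply, ite_smul]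

/-- An equation of the variety vanishes on the whole torus orbit of `v`, so its pullback to `k[Λ]`
is zero. Evaluating this identity at the dual-number point `m ↦ 1 + ε l(m)` of the torus
differentiates the orbit map. Zero coordinates of `v` are allowed, as is needed for points of a
Gauss fiber outside the torus. -/
theorem mul_mem_embeddedTangentSpace [CharZero k] [Module.Free ℤ Λ] (h : Λ →ₗ[ℤ] ℤ) {a : ι → Λ}
    (ha : ∀ u, h (a u) = 1) {v : ι → k} (hv : v ≠ 0)
    (hvX : Projectivization.mk k v hv ∈ binomialLocus k a) (l : Λ →ₗ[ℤ] k) :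
    v * weightMap k a l ∈ embeddedTangentSpace (binomialLocus k a)
      (Projectivization.mk k v hv) := by
  rw [mem_embeddedTangentSpace_mk]
  intro f d hf hfX
  have h0 : orbitPullback a v f = 0 := by
    refine eq_zero_of_torusEval fun t => ?_
    have := hfX _ (torusMove_mem_binomialLocus h ha t hvX)
    rwa [torusMove_mk, eval_rep_mk hf, ← torusEval_orbitPullback] at this
  let χ : Multiplicative Λ →* DualNumber k :=
    { toFun := fun m => 1 + TrivSqZeroExt.inr (l m.toAdd)
      map_one' := by simp
      map_mul' := fun m m' => by
        ext
        · simp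
        · simp [add_comm] }
  have h1 := congrArg (AddMonoidAlgebra.lift k (DualNumber k) Λ χ) h0
  rw [map_zero, orbitPullback, comp_aeval_apply] at h1
  have h2 : (fun u => AddMonoidAlgebra.lift k (DualNumber k) Λ χ
      (AddMonoidAlgebra.single (a u) (v u))) = fun u =>
        (TrivSqZeroExt.inl (v u) + TrivSqZeroExt.inr ((v * weightMap k a l) u) : DualNumber k) := by
    funext u
    rw [AddMonoidAlgebra.lift_single]
    ext <;> simp [χ]
  rw [h2, snd_aeval_dual] at h1
  simpa using congrArg TrivSqZeroExt.snd h1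

theorem torusMove_image_binomialLocus (h : Λ →ₗ[ℤ] ℤ) {a : ι → Λ} (ha : ∀ u, h (a u) = 1)
    (t : Torus k Λ) : torusMove a t '' binomialLocus k a = binomialLocus k a := by
  apply Set.Subset.antisymm
  · rintro _ ⟨p, hp, rfl⟩
    exact torusMove_mem_binomialLocus h ha t hp
  · intro p hp
    refine ⟨_, torusMove_mem_binomialLocus h ha t⁻¹ hp, ?_⟩
    rw [← torusMove_mul, show t * t⁻¹ = 1 from mul_inv_cancel t, torusMove_one]

theorem embeddedTangentSpace_torusMove (h : Λ →ₗ[ℤ] ℤ) {a : ι → Λ} (ha : ∀ u, h (a u) = 1)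
    (t : Torus k Λ) {p : ℙ k (ι → k)} (hp : p ∈ binomialLocus k a) :
    embeddedTangentSpace (binomialLocus k a) (torusMove a t p) =
      (embeddedTangentSpace (binomialLocus k a) p).map (torusScale a t).toLinearMap := by
  have := embeddedTangentSpace_map (torusScale a t).toLinearMap (torusScale a t).injective _ hp
  change embeddedTangentSpace (torusMove a t '' _) (torusMove a t p) = _ at this
  rwa [torusMove_image_binomialLocus h ha] at this

theorem gaussFiber_torusMove (h : Λ →ₗ[ℤ] ℤ) {a : ι → Λ} (ha : ∀ u, h (a u) = 1)
    (t : Torus k Λ) {p : ℙ k (ι → k)} (hp : p ∈ binomialLocus k a) :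
    gaussFiber (binomialLocus k a) (torusMove a t p) =
      torusMove a t '' gaussFiber (binomialLocus k a) p := by
  have := gaussFiber_map (torusScale a t).toLinearMap (torusScale a t).injective _ hp
  change gaussFiber (torusMove a t '' _) (torusMove a t p) = _ at this
  rwa [torusMove_image_binomialLocus h ha] at this

variable [Nonempty ι]

/-- The differential at `1` of a binomial imposes `∑ α u * w u = ∑ β u * w u`. Together these
equations say that `w` respects all relations among the generators, hence extends to `Λ`. -/
theorem embeddedTangentSpace_unitPoint [CharZero k] [Module.Free ℤ Λ] (h : Λ →ₗ[ℤ] ℤ) {a : ι → Λ}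
    (ha : ∀ u, h (a u) = 1) (hspan : Submodule.span ℤ (Set.range a) = ⊤) :
    embeddedTangentSpace (binomialLocus k a) (unitPoint k ι) = LinearMap.range (weightMap k a) := by
  apply le_antisymm
  · intro w hw
    have hw' := (mem_embeddedTangentSpace_mk (one_ne_zero (α := ι → k))).1 hw
    obtain ⟨l, hl⟩ := exists_hom_of_weight_eq hspan w fun α β hαβ => by
      have := hw' _ _ (isHomogeneous_binomial (sum_eq_of_weight_eq h ha hαβ)) fun p hp => by
        rw [eval_binomial, sub_eq_zero]
        exact hp α β hαβ
      simp only [map_sub, pderiv_monomial, eval_monomial, sub_mul, Finset.sum_sub_distrib,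
        Pi.one_apply, one_pow, Finsupp.prod, Finset.prod_const_one, one_mul, mul_one,
        sub_eq_zero] at this
      simpa [weight] using this
    exact ⟨l.toIntLinearMap, funext hl⟩
  · rintro _ ⟨l, rfl⟩
    simpa [unitPoint] using mul_mem_embeddedTangentSpace h ha one_ne_zero
      (unitPoint_mem_binomialLocus h ha) l

/-- The binomial equations are the conditions for the coordinates, taken as units, to extend to a
homomorphism from `Λ` to `kˣ`. -/
theorem mk_mem_orbit {a : ι → Λ} (hspan : Submodule.span ℤ (Set.range a) = ⊤) {v : ι → k}
    (hv : v ≠ 0) (hs : SatisfiesBinomials a v) (hv0 : ∀ u, v u ≠ 0) :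
    ∃ t : Torus k Λ, torusScale a t 1 = v ∧
      torusMove a t (unitPoint k ι) = Projectivization.mk k v hv := by
  obtain ⟨l, hl⟩ := exists_hom_of_weight_eq hspan
    (fun u => Additive.ofMul (Units.mk0 (v u) (hv0 u))) fun α β hαβ => by
      apply Additive.toMul.injective
      ext
      simpa [weight] using hs α β hαβ
  have ht : torusScale a (AddMonoidHom.toMultiplicativeLeft l) 1 = v := by
    ext u
    simp [hl]
  refine ⟨AddMonoidHom.toMultiplicativeLeft l, ht, ?_⟩
  rw [unitPoint, torusMove_mk]
  congr 1

theorem torusMove_unitPoint_mem_smoothLocus [CharZero k] [Module.Free ℤ Λ] [Module.Finite ℤ Λ]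
    (h : Λ →ₗ[ℤ] ℤ) {a : ι → Λ} (ha : ∀ u, h (a u) = 1)
    (hspan : Submodule.span ℤ (Set.range a) = ⊤) (t : Torus k Λ) :
    torusMove a t (unitPoint k ι) ∈ smoothLocus (binomialLocus k a) := by
  have h1 := unitPoint_mem_binomialLocus (k := k) h ha
  refine ⟨torusMove_mem_binomialLocus h ha t h1, ?_⟩
  rw [embeddedTangentSpace_torusMove h ha t h1, embeddedTangentSpace_unitPoint h ha hspan,
    LinearEquiv.finrank_map_eq, finrank_range_weightMap hspan,
    ← finrank_ker_add_one h (ha (Classical.arbitrary ι)),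
    topologicalKrullDim_eq_of_orbit_subset h ha hspan
      (finrank_ker_add_one h (ha (Classical.arbitrary ι))).symm
      (orbit_subset_binomialLocus h ha) subset_rfl]
  push_cast
  rfl

end Tangent

/-! ### Multiplier algebras and partitions into blocks -/

section Blocks

variable {k : Type*} [Field k] {ι : Type*}

/-- The multiplication operators that preserve a subspace of `k^ι`. -/
def stabilizer (V : Submodule k (ι → k)) : Subalgebra k (ι → k) where
  carrier := {g | ∀ w ∈ V, g * w ∈ V}
  mul_mem' hf hg w hw := by rw [mul_assoc]; exact hf _ (hg w hw)
  add_mem' hf hg w hw := by rw [add_mul]; exact V.add_mem (hf w hw) (hg w hw)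
  algebraMap_mem' c w hw := by rw [← Algebra.smul_def]; exact V.smul_mem c hw

/-- The weights of the torus of the simplex whose vertices are the blocks of a partition. -/
def blockWeight {δ : ℕ} (B : ι → Fin (δ + 1)) (u : ι) : Fin (δ + 1) → ℤ := Pi.single (B u) 1

/-- The sum of coordinates. -/
def coordSum (δ : ℕ) : (Fin (δ + 1) → ℤ) →ₗ[ℤ] ℤ := ∑ i, LinearMap.proj i

theorem coordSum_blockWeight {δ : ℕ} (B : ι → Fin (δ + 1)) (u : ι) :
    coordSum δ (blockWeight B u) = 1 := by
  simp [coordSum, blockWeight]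

theorem span_blockWeight {δ : ℕ} {B : ι → Fin (δ + 1)} (hB : Function.Surjective B) :
    Submodule.span ℤ (Set.range (blockWeight B)) = ⊤ := by
  rw [eq_top_iff, ← (Pi.basisFun ℤ (Fin (δ + 1))).span_eq]
  apply Submodule.span_mono
  rintro _ ⟨i, rfl⟩
  obtain ⟨u, rfl⟩ := hB i
  exact ⟨u, by simp [blockWeight]⟩

theorem indicator_ne_zero {δ : ℕ} {B : ι → Fin (δ + 1)} (hBs : Function.Surjective B)
    (i : Fin (δ + 1)) : (fun u => if B u = i then (1 : k) else 0) ≠ 0 := by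
  obtain ⟨u, rfl⟩ := hBs i
  intro h
  simpa using congrFun h u

theorem mem_stabilizer_of_const {Λ : Type*} [AddCommGroup Λ] {δ : ℕ} {B : ι → Fin (δ + 1)}
    {a : ι → Λ} (hBs : Function.Surjective B)
    (hB : ∀ i, (fun u => if B u = i then 1 else 0) ∈ stabilizer (LinearMap.range (weightMap k a)))
    {v : ι → k} (hv : ∀ u u', B u = B u' → v u = v u') :
    v ∈ stabilizer (LinearMap.range (weightMap k a)) := by
  have : v = ∑ i, v (hBs i).choose • fun u => if B u = i then (1 : k) else 0 := by
    ext u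
    simp only [Finset.sum_apply, Pi.smul_apply, smul_eq_mul, mul_ite, mul_one, mul_zero,
      Finset.sum_ite_eq, Finset.mem_univ, if_true]
    exact hv _ _ (hBs (B u)).choose_spec.symm
  rw [this]
  exact Subalgebra.sum_mem _ fun i _ => Subalgebra.smul_mem _ (hB i) _

variable [Fintype ι]

/-- A subalgebra of `k^ι` consists of the functions that are constant on the blocks of a
partition. -/
theorem exists_partition_of_subalgebra [Nonempty ι] (S : Subalgebra k (ι → k)) :
    ∃ (δ : ℕ) (B : ι → Fin (δ + 1)), Function.Surjective B ∧
      (∀ i, (fun u => if B u = i then 1 else 0) ∈ S) ∧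
      ∀ g ∈ S, ∀ u u', B u = B u' → g u = g u' := by
  classical
  let r : Setoid ι :=
    { r := fun u u' => ∀ g ∈ S, g u = g u'
      iseqv := ⟨fun _ _ _ => rfl, fun h g hg => (h g hg).symm,
        fun h h' g hg => (h g hg).trans (h' g hg)⟩ }
  have : Nonempty (Quotient r) := ⟨Quotient.mk r (Classical.arbitrary ι)⟩
  have hcard : Fintype.card (Quotient r) = (Fintype.card (Quotient r) - 1) + 1 :=
    (Nat.sub_add_cancel Fintype.card_pos).symm
  let e := (Fintype.equivFin (Quotient r)).trans (finCongr hcard)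
  refine ⟨_, fun u => e (Quotient.mk r u), e.surjective.comp Quotient.mk_surjective, ?_, ?_⟩
  · intro i
    obtain ⟨q, rfl⟩ := e.surjective i
    obtain ⟨u, rfl⟩ := Quotient.mk_surjective q
    simp only [e.injective.eq_iff]
    -- The product over `u'` of these separating functions is the indicator of the class of `u`.
    have hsep : ∀ u', ∃ g ∈ S, g u = 1 ∧ (¬ r u' u → g u' = 0) := by
      intro u'
      by_cases hu : r u' u
      · exact ⟨1, S.one_mem, rfl, fun h => absurd hu h⟩
      · obtain ⟨g, hg, hne⟩ : ∃ g ∈ S, g u' ≠ g u := by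
          by_contra! hcon
          exact hu hcon
        have hne' : g u - g u' ≠ 0 := sub_ne_zero.2 hne.symm
        refine ⟨(g u - g u')⁻¹ • (g - algebraMap k (ι → k) (g u')),
          S.smul_mem (S.sub_mem hg (S.algebraMap_mem _)) _, ?_, fun _ => ?_⟩
        · simp [inv_mul_cancel₀ hne']
        · simp
    choose g hgS hgu hgu' using hsep
    have hprod : ∏ u', g u' ∈ S := S.prod_mem fun u' _ => hgS u'
    convert hprod using 1
    ext u'
    rw [Finset.prod_apply]
    by_cases hu : r u' u
    · rw [if_pos (Quotient.sound hu)]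
      symm
      exact Finset.prod_eq_one fun w _ => (hu _ (hgS w)).trans (hgu w)
    · rw [if_neg fun h => hu (Quotient.exact h)]
      exact (Finset.prod_eq_zero (f := fun c => g c u') (Finset.mem_univ u') (hgu' u' hu)).symm
  · intro g hg u u' h
    exact Quotient.exact (e.injective h) g hg

theorem weight_blockWeight {δ : ℕ} (B : ι → Fin (δ + 1)) (α : ι →₀ ℕ) (i : Fin (δ + 1)) :
    weight (blockWeight B) α i = ((∑ u with B u = i, α u : ℕ) : ℤ) := by
  simp [weight, blockWeight, Pi.single_apply, Finset.sum_filter, eq_comm]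

/-- Equal block weights mean equal degrees in each block, and on a block all coordinates of `v`
agree. -/
theorem satisfiesBinomials_blockWeight {δ : ℕ} {B : ι → Fin (δ + 1)} {v : ι → k}
    (hv : ∀ u u', B u = B u' → v u = v u') : SatisfiesBinomials (blockWeight B) v := by
  intro α β hαβ
  rw [← Finset.prod_fiberwise _ B, ← Finset.prod_fiberwise _ B]
  refine Finset.prod_congr rfl fun i _ => ?_
  have hi : ∑ u with B u = i, α u = ∑ u with B u = i, β u := by
    have := congrFun hαβ i
    rw [weight_blockWeight, weight_blockWeight] at this
    exact_mod_cast this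
  rcases (Finset.univ.filter fun u => B u = i).eq_empty_or_nonempty with h0 | ⟨u₀, hu₀⟩
  · simp [h0]
  · have hconst : ∀ γ : ι →₀ ℕ, ∏ u with B u = i, v u ^ γ u = v u₀ ^ ∑ u with B u = i, γ u := by
      intro γ
      rw [← Finset.prod_pow_eq_pow_sum]
      refine Finset.prod_congr rfl fun u hu => ?_
      rw [hv u u₀ (by simp at hu hu₀; rw [hu, hu₀])]
    rw [hconst, hconst, hi]

end Blocks

/-! ### The general fiber of the Gauss map -/

section GaussDefect

variable {k : Type*} [Field k] [CharZero k] {Λ : Type*} [AddCommGroup Λ] [Module.Free ℤ Λ]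
  {ι : Type*} [Fintype ι] {δ : ℕ}
  {B : ι → Fin (δ + 1)} {a : ι → Λ}

/-- The part of an exponent vector that lies in a block. -/
def blockPart (B : ι → Fin (δ + 1)) (i : Fin (δ + 1)) (α : ι →₀ ℕ) : ι →₀ ℕ :=
  α.filter fun u => B u = i

/-- If the indicators of the blocks preserve the linear functions, then every relation between the
weights is a sum of relations inside the blocks. -/
theorem weight_blockPart_eq
    (hB : ∀ i, (fun u => if B u = i then 1 else 0) ∈ stabilizer (LinearMap.range (weightMap k a)))
    {α β : ι →₀ ℕ} (hαβ : weight a α = weight a β) (i : Fin (δ + 1)) :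
    weight a (blockPart B i α) = weight a (blockPart B i β) := by
  refine eq_of_forall_linearMap_eq (k := k) fun l => ?_
  -- `l'` is linear on `Λ`, agrees with `l` on the weights of block `i` and vanishes on those of the
  -- other blocks.
  obtain ⟨l', hl'⟩ := hB i _ ⟨l, rfl⟩
  have key : ∀ γ : ι →₀ ℕ, l (weight a (blockPart B i γ)) = l' (weight a γ) := by
    intro γ
    simp only [weight, map_sum, map_nsmul]
    refine Finset.sum_congr rfl fun u _ => ?_
    have := congrFun hl' u
    simp only [weightMap_apply, Pi.mul_apply] at this
    rw [this, blockPart, Finsupp.filter_apply]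
    split_ifs <;> simp
  rw [key, key, hαβ]

theorem weight_blockWeight_eq (h : Λ →ₗ[ℤ] ℤ) (ha : ∀ u, h (a u) = 1)
    (hB : ∀ i, (fun u => if B u = i then 1 else 0) ∈ stabilizer (LinearMap.range (weightMap k a)))
    {α β : ι →₀ ℕ} (hαβ : weight a α = weight a β) :
    weight (blockWeight B) α = weight (blockWeight B) β := by
  ext i
  have key : ∀ γ : ι →₀ ℕ, ∑ u with B u = i, γ u = ∑ u, blockPart B i γ u := fun γ => by
    simp [blockPart, Finsupp.filter_apply, Finset.sum_filter]
  rw [weight_blockWeight, weight_blockWeight, key, key,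
    sum_eq_of_weight_eq h ha (weight_blockPart_eq hB hαβ i)]

theorem satisfiesBinomials_of_const (h : Λ →ₗ[ℤ] ℤ) (ha : ∀ u, h (a u) = 1)
    (hB : ∀ i, (fun u => if B u = i then 1 else 0) ∈ stabilizer (LinearMap.range (weightMap k a)))
    {v : ι → k} (hv : ∀ u u', B u = B u' → v u = v u') : SatisfiesBinomials a v :=
  fun α β hαβ => satisfiesBinomials_blockWeight hv α β (weight_blockWeight_eq h ha hB hαβ)

variable [Nonempty ι]

/-- For `[v]` in the fiber, `v * V` is tangent at `[v]`, hence contained in `V`. So `v` is a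
multiplier of `V` and is constant on blocks. -/
theorem gaussFiber_unitPoint_subset (h : Λ →ₗ[ℤ] ℤ) (ha : ∀ u, h (a u) = 1)
    (hspan : Submodule.span ℤ (Set.range a) = ⊤)
    (hS : ∀ g ∈ stabilizer (LinearMap.range (weightMap k a)), ∀ u u', B u = B u' → g u = g u') :
    gaussFiber (binomialLocus k a) (unitPoint k ι) ⊆ binomialLocus k (blockWeight B) := by
  rintro y ⟨hy, hT⟩
  induction y using Projectivization.ind with
  | h v hv =>
    rw [embeddedTangentSpace_unitPoint h ha hspan] at hT
    rw [mk_mem_binomialLocus (coordSum δ) (coordSum_blockWeight B)]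
    refine satisfiesBinomials_blockWeight (hS v ?_)
    rintro _ ⟨l, rfl⟩
    rw [← hT]
    exact mul_mem_embeddedTangentSpace h ha hv hy.1 l

variable [Module.Finite ℤ Λ]

/-- A block-constant vector `v` without zeros is a point of the big torus. It is also a multiplier,
so the translated tangent space `v * V` lies in `V` and equals it by dimension. -/
theorem orbit_blockWeight_subset (h : Λ →ₗ[ℤ] ℤ) (ha : ∀ u, h (a u) = 1)
    (hspan : Submodule.span ℤ (Set.range a) = ⊤) (hBs : Function.Surjective B)
    (hB : ∀ i, (fun u => if B u = i then 1 else 0) ∈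
      stabilizer (LinearMap.range (weightMap k a))) :
    orbit (blockWeight B) (unitPoint k ι) ⊆ gaussFiber (binomialLocus k a) (unitPoint k ι) := by
  rintro _ ⟨s, rfl⟩
  set v : ι → k := torusScale (blockWeight B) s 1 with hv
  have hv0 : ∀ u, v u ≠ 0 := fun u => by simp [hv]
  have hvne : v ≠ 0 := fun h0 => hv0 (Classical.arbitrary ι) (congrFun h0 _)
  have hconst : ∀ u u', B u = B u' → v u = v u' := fun u u' huu => by
    simp [hv, blockWeight, huu]
  obtain ⟨t, htv, ht⟩ := mk_mem_orbit hspan hvne (satisfiesBinomials_of_const h ha hB hconst) hv0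
  have hs : torusMove (blockWeight B) s (unitPoint k ι) = torusMove a t (unitPoint k ι) := ht.symm
  change torusMove (blockWeight B) s (unitPoint k ι) ∈ _
  have h1 := unitPoint_mem_binomialLocus (k := k) h ha
  rw [hs]
  refine ⟨torusMove_unitPoint_mem_smoothLocus h ha hspan t, ?_⟩
  rw [embeddedTangentSpace_torusMove h ha t h1, embeddedTangentSpace_unitPoint h ha hspan]
  have hscale : ∀ w, torusScale a t w = v * w := fun w => by
    rw [← htv]; ext u; simp
  apply Submodule.eq_of_le_of_finrank_eq
  · rintro _ ⟨w, hw, rfl⟩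
    change torusScale a t w ∈ _
    rw [hscale]
    exact mem_stabilizer_of_const hBs hB hconst w hw
  · exact LinearEquiv.finrank_map_eq _ _

theorem isGaussDefect_binomialLocus (h : Λ →ₗ[ℤ] ℤ) (ha : ∀ u, h (a u) = 1)
    (hspan : Submodule.span ℤ (Set.range a) = ⊤) (hBs : Function.Surjective B)
    (hB : ∀ i, (fun u => if B u = i then 1 else 0) ∈ stabilizer (LinearMap.range (weightMap k a)))
    (hS : ∀ g ∈ stabilizer (LinearMap.range (weightMap k a)), ∀ u u', B u = B u' → g u = g u') :
    IsGaussDefect (binomialLocus k a) δ := by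
  have h1 := unitPoint_mem_binomialLocus (k := k) h ha
  have hrep : ∀ (v : ι → k) (hv : v ≠ 0) u,
      (Projectivization.mk k v hv).rep u = 0 ↔ v u = 0 := fun v hv u => by
    simpa using eval_rep_mk (isHomogeneous_X k u) v hv
  -- On the open set where no coordinate vanishes, the variety is the single orbit of the unit
  -- point, so one fiber determines all.
  refine ⟨⋂ u, {p | p.rep u = 0}ᶜ, ?_, ⟨unitPoint k ι, h1, ?_⟩, ?_⟩
  · refine isOpen_iInter_of_finite fun u => IsClosed.isOpen_compl (self := ?_)
    simpa using isClosed_eval_eq_zero (isHomogeneous_X k u)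
  · simp only [Set.mem_iInter]
    intro u
    change ¬ _ = _
    rw [unitPoint, hrep]
    exact one_ne_zero
  · rintro x ⟨hx, hxU⟩
    simp only [Set.mem_iInter] at hxU
    induction x using Projectivization.ind with
    | h v hv =>
      obtain ⟨t, -, ht⟩ := mk_mem_orbit hspan hv ((mk_mem_binomialLocus h ha hv).1 hx)
        fun u h0 => hxU u ((hrep v hv u).2 h0)
      rw [← ht]
      refine ⟨torusMove_unitPoint_mem_smoothLocus h ha hspan t, ?_⟩
      rw [gaussFiber_torusMove h ha t h1]
      refine (topologicalKrullDim_image _ _ _).trans ?_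
      exact topologicalKrullDim_eq_of_orbit_subset (coordSum δ) (coordSum_blockWeight B)
        (span_blockWeight hBs) (by simp) (orbit_blockWeight_subset h ha hspan hBs hB)
        (gaussFiber_unitPoint_subset h ha hspan hS)

end GaussDefect

/-! ### Decomposition as a join -/

section Join

variable {k : Type*} [Field k] {Λ : Type*} [AddCommGroup Λ] {ι : Type*} {δ : ℕ}
  {B : ι → Fin (δ + 1)} {a : ι → Λ}

/-- The closed torus orbit of the indicator of a block. -/
def blockVariety (k : Type*) [Field k] (a : ι → Λ) (hBs : Function.Surjective B)
    (i : Fin (δ + 1)) : Set (ℙ k (ι → k)) :=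
  closure (orbit a (Projectivization.mk k _ (indicator_ne_zero (k := k) hBs i)))

theorem rep_eq_zero_of_mem_blockVariety (hBs : Function.Surjective B) {i : Fin (δ + 1)}
    {p : ℙ k (ι → k)} (hp : p ∈ blockVariety k a hBs i) {u : ι} (hu : B u ≠ i) : p.rep u = 0 := by
  have := mem_closure_iff_eval.1 hp (X u) 1 (isHomogeneous_X k u) ?_
  · simpa using this
  · rintro _ ⟨t, rfl⟩
    simp only [torusMove_mk]
    rw [eval_rep_mk (isHomogeneous_X k u)]
    simp [hu]

theorem disjoint_blockVariety (hBs : Function.Surjective B) {i i' : Fin (δ + 1)} (hi : i ≠ i') :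
    Disjoint (blockVariety k a hBs i) (blockVariety k a hBs i') := by
  rw [Set.disjoint_left]
  intro p hp hp'
  apply p.rep_nonzero
  ext u
  by_cases hu : B u = i
  · exact rep_eq_zero_of_mem_blockVariety hBs hp' (hu ▸ hi)
  · exact rep_eq_zero_of_mem_blockVariety hBs hp hu

variable [CharZero k] [Module.Free ℤ Λ] [Fintype ι]

theorem blockVariety_subset (h : Λ →ₗ[ℤ] ℤ) (ha : ∀ u, h (a u) = 1) (hBs : Function.Surjective B)
    (hB : ∀ i, (fun u => if B u = i then 1 else 0) ∈ stabilizer (LinearMap.range (weightMap k a)))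
    (i : Fin (δ + 1)) : blockVariety k a hBs i ⊆ binomialLocus k a := by
  refine closure_minimal ?_ (isClosed_binomialLocus h ha)
  rintro _ ⟨t, rfl⟩
  refine torusMove_mem_binomialLocus h ha t ((mk_mem_binomialLocus h ha _).2 ?_)
  exact satisfiesBinomials_of_const h ha hB fun u u' huu => by simp [huu]

/-- Points of a toric variety that are supported on different blocks can be added. -/
theorem satisfiesBinomials_sum
    (hB : ∀ i, (fun u => if B u = i then 1 else 0) ∈ stabilizer (LinearMap.range (weightMap k a)))
    {v : Fin (δ + 1) → ι → k} (hv : ∀ i, SatisfiesBinomials a (v i))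
    (hv0 : ∀ i u, B u ≠ i → v i u = 0) : SatisfiesBinomials a (∑ i, v i) := by
  have hsum : ∀ u, (∑ i, v i) u = v (B u) u := fun u => by
    rw [Finset.sum_apply]
    exact Finset.sum_eq_single _ (fun i _ hi => hv0 i u hi.symm) (by simp)
  -- Each coordinate of the sum comes from the summand of its own block, so a monomial factors into
  -- its block parts.
  have hprod : ∀ γ : ι →₀ ℕ, ∏ u, (∑ i, v i) u ^ γ u = ∏ i, ∏ u, v i u ^ blockPart B i γ u := by
    intro γ
    rw [Finset.prod_comm]
    refine Finset.prod_congr rfl fun u _ => ?_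
    rw [hsum, Finset.prod_eq_single (B u)]
    · simp [blockPart]
    · intro i _ hi
      simp [blockPart, hi.symm]
    · simp
  intro α β hαβ
  rw [hprod, hprod]
  exact Finset.prod_congr rfl fun i _ => hv i _ _ (weight_blockPart_eq hB hαβ i)

variable [Nonempty ι]

/-- Points of the span are sums of multiples of solutions supported on different blocks, hence
solutions. Conversely, the unit point is the sum of the block indicators; the torus carries this
decomposition over its orbit, which is dense. -/
theorem join_blockVariety (h : Λ →ₗ[ℤ] ℤ) (ha : ∀ u, h (a u) = 1) (hBs : Function.Surjective B)
    (hB : ∀ i, (fun u => if B u = i then 1 else 0) ∈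
      stabilizer (LinearMap.range (weightMap k a))) :
    join (blockVariety k a hBs) = binomialLocus k a := by
  apply Set.Subset.antisymm
  · refine closure_minimal ?_ (isClosed_binomialLocus h ha)
    rintro p ⟨x, hx, hp⟩
    have hle : Projectivization.Subspace.span (Set.range x) ≤
        (Submodule.span k (Set.range fun i => (x i).rep)).projectivization := by
      rw [Projectivization.Subspace.span_le_subspace_iff]
      rintro _ ⟨i, rfl⟩
      have := (Submodule.mk_mem_projectivization_iff _ (x i).rep_nonzero).2
        (Submodule.subset_span (R := k) (s := Set.range fun i => (x i).rep) ⟨i, rfl⟩)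
      rwa [Projectivization.mk_rep] at this
    have hp' := hle hp
    induction p using Projectivization.ind with
    | h v hv =>
      rw [Submodule.mk_mem_projectivization_iff, Submodule.mem_span_range_iff_exists_fun] at hp'
      obtain ⟨c, rfl⟩ := hp'
      rw [mk_mem_binomialLocus h ha]
      refine satisfiesBinomials_sum hB (fun i => ?_) fun i u hu => ?_
      · exact SatisfiesBinomials.mul_left h ha (blockVariety_subset h ha hBs hB i (hx i)) (c i)
      · simp [rep_eq_zero_of_mem_blockVariety hBs (hx i) hu]
  · rw [← closure_orbit_eq h ha]
    refine closure_mono ?_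
    rintro _ ⟨t, rfl⟩
    refine ⟨fun i => torusMove a t (Projectivization.mk k _ (indicator_ne_zero hBs i)),
      fun i => subset_closure ⟨t, rfl⟩, ?_⟩
    simp only [unitPoint, torusMove_mk]
    rw [← Projectivization.Subspace.mem_submodule_iff]
    have hsum : torusScale a t 1 =
        ∑ i, torusScale a t fun u => if B u = i then (1 : k) else 0 := by
      rw [← map_sum]
      congr 1
      ext u
      simp
    rw [hsum]
    refine Submodule.sum_mem _ fun i _ => ?_
    rw [Projectivization.Subspace.mem_submodule_iff _
      ((torusScale a t).map_ne_zero_iff.2 (indicator_ne_zero hBs i))]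
    exact Projectivization.Subspace.subset_span _ ⟨i, rfl⟩

end Join

/-- The structure of a toric variety whose lattice is generated by the weights. -/
theorem exists_join_decomposition {k : Type*} [Field k] [CharZero k] {Λ : Type*} [AddCommGroup Λ]
    [Module.Free ℤ Λ] [Module.Finite ℤ Λ] {ι : Type*} [Fintype ι] [Nonempty ι] (h : Λ →ₗ[ℤ] ℤ)
    {a : ι → Λ} (ha : ∀ u, h (a u) = 1) (hspan : Submodule.span ℤ (Set.range a) = ⊤) :
    ∃ δ : ℕ, IsGaussDefect (binomialLocus k a) δ ∧
      ∃ Y : Fin (δ + 1) → Set (ℙ k (ι → k)),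
        (∀ i, IsProjectiveVariety (Y i) ∧ Y i ⊆ binomialLocus k a ∧
          ∀ t : Torus k Λ, ∀ y ∈ Y i, torusMove a t y ∈ Y i) ∧
        (∀ i i', i ≠ i' → Disjoint (Y i) (Y i')) ∧ join Y = binomialLocus k a := by
  obtain ⟨δ, B, hBs, hB, hS⟩ :=
    exists_partition_of_subalgebra (stabilizer (LinearMap.range (weightMap k a)))
  refine ⟨δ, isGaussDefect_binomialLocus h ha hspan hBs hB hS, blockVariety k a hBs,
    fun i => ⟨⟨isClosed_closure, (isIrreducible_orbit _ _).closure⟩,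
      blockVariety_subset h ha hBs hB i, fun t y hy => torusMove_mem_closure_orbit t hy⟩,
    fun i i' => disjoint_blockVariety hBs, join_blockVariety h ha hBs hB⟩

/-! ### From the lattice `M` to the lattice at height one -/

section ToricVariety

variable {k : Type*} [Field k] {M : Type*} [AddCommGroup M]

/-- Closed points of a quotient torus lift, since the units of `k` form a divisible group. -/
theorem exists_torus_extension [IsAlgClosed k] [CharZero k] (Λ : Submodule ℤ M) (s : Torus k Λ) :
    ∃ t : Torus k M, ∀ m : Λ, t (Multiplicative.ofAdd (m : M)) = s (Multiplicative.ofAdd m) := by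
  let _ : DivisibleBy (Additive kˣ) ℕ :=
    divisibleByOfSMulRightSurj _ _ fun {n} hn x => by
    obtain ⟨z, hz⟩ := IsAlgClosed.exists_pow_nat_eq (x.toMul : k) (Nat.pos_of_ne_zero hn)
    have hz0 : z ≠ 0 := by
      rintro rfl
      rw [zero_pow hn] at hz
      exact x.toMul.ne_zero hz.symm
    exact ⟨Additive.ofMul (Units.mk0 z hz0),
      Additive.toMul.injective (Units.ext (by simpa using hz))⟩
  let _ : DivisibleBy (Additive kˣ) ℤ := AddGroup.divisibleByIntOfDivisibleByNat _
  obtain ⟨g, hg⟩ := (Module.Baer.of_divisible (Additive kˣ)).extension_property_addMonoidHom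
    Λ.subtype.toAddMonoidHom Λ.subtype_injective (MonoidHom.toAdditiveRight s)
  refine ⟨AddMonoidHom.toMultiplicativeLeft g, fun m => ?_⟩
  exact congrArg Additive.toMul (DFunLike.congr_fun hg m)

/-- The point of `A`, placed at height one. -/
def liftPoint (A : Finset M) (u : A) : M × ℤ := (u, 1)

/-- The lattice generated by `A` at height one. -/
abbrev coneLattice (A : Finset M) : Submodule ℤ (M × ℤ) :=
  Submodule.span ℤ (Set.range (liftPoint A))

/-- The points of `A` as generators of their lattice. -/
def generator (A : Finset M) (u : A) : coneLattice A :=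
  ⟨liftPoint A u, Submodule.subset_span ⟨u, rfl⟩⟩

/-- The height on the lattice generated by `A` at height one. -/
def height (A : Finset M) : coneLattice A →ₗ[ℤ] ℤ :=
  LinearMap.snd ℤ M ℤ ∘ₗ (coneLattice A).subtype

theorem height_generator (A : Finset M) (u : A) : height A (generator A u) = 1 := rfl

theorem span_generator (A : Finset M) : Submodule.span ℤ (Set.range (generator A)) = ⊤ := by
  apply Submodule.map_injective_of_injective (coneLattice A).subtype_injective
  rw [Submodule.map_span, ← Set.range_comp, Submodule.map_top, Submodule.range_subtype]
  rfl

/-- The torus of the lattice generated by `A` receives the torus of `M`. -/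
def torusRestrict (A : Finset M) (t : Torus k M) : Torus k (coneLattice A) :=
  t.comp (AddMonoidHom.toMultiplicative
    (LinearMap.fst ℤ M ℤ ∘ₗ (coneLattice A).subtype).toAddMonoidHom)

theorem torusMove_torusRestrict (A : Finset M) (t : Torus k M) (p : ℙ k (A → k)) :
    torusMove (generator A) (torusRestrict A t) p = torusAction A t p := rfl

/-- A point of the torus of `coneLattice A` extends to `M × ℤ`. Its value at `(0, 1)` multiplies all
coordinates alike and disappears projectively, so only its restriction to `M` matters. -/
theorem range_toricMap [IsAlgClosed k] [CharZero k] (A : Finset M) (hA : A.Nonempty) [Nonempty A] :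
    Set.range (toricMap (k := k) A hA) = orbit (generator A) (unitPoint k A) := by
  apply Set.Subset.antisymm
  · rintro _ ⟨t, rfl⟩
    refine ⟨torusRestrict A t, ?_⟩
    simp only [unitPoint, torusMove_mk, toricMap]
    congr 1
    ext u
    simp [torusRestrict, generator, liftPoint]
  · rintro _ ⟨s, rfl⟩
    obtain ⟨S, hS⟩ := exists_torus_extension _ s
    refine ⟨S.comp (AddMonoidHom.toMultiplicative (AddMonoidHom.inl M ℤ)), ?_⟩
    simp only [unitPoint, torusMove_mk, toricMap]
    rw [Projectivization.mk_eq_mk_iff']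
    refine ⟨((S (Multiplicative.ofAdd (0, 1)))⁻¹ : kˣ), ?_⟩
    ext u
    have h1 : (Multiplicative.ofAdd ((generator A u : M × ℤ))) =
        Multiplicative.ofAdd ((u : M), (0 : ℤ)) * Multiplicative.ofAdd ((0 : M), (1 : ℤ)) := by
      rw [← ofAdd_add]
      simp [generator, liftPoint]
    simp only [Pi.smul_apply, torusScale_apply, Pi.one_apply, mul_one, ← hS, h1, map_mul]
    simp [mul_comm]

theorem toricVariety_eq [IsAlgClosed k] [CharZero k] [Module.Free ℤ M] [Module.Finite ℤ M]
    (A : Finset M) (hA : A.Nonempty) [Nonempty A] :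
    toricVariety k A hA = binomialLocus k (generator A) := by
  rw [toricVariety, range_toricMap, closure_orbit_eq (height A) (height_generator A)]

/-- The torus points of a toric variety span the ambient space. -/
theorem eq_top_of_toricMap_mem [CharZero k] [Module.Free ℤ M] (A : Finset M)
    (N : Submodule k (A → k))
    (hN : ∀ t : Torus k M, (fun u : A => (t (Multiplicative.ofAdd (u : M)) : k)) ∈ N) : N = ⊤ := by
  classical
  by_contra hne
  obtain ⟨φ, hφ, hker⟩ := Submodule.exists_le_ker_of_lt_top N (lt_top_iff_ne_top.2 hne)
  apply hφ
  -- A linear form that vanishes on the torus points is a Laurent polynomial that vanishes on the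
  -- torus; its coefficients are those of the form, as the exponents are distinct.
  let F : AddMonoidAlgebra k M := ∑ u : A, AddMonoidAlgebra.single (u : M) (φ (Pi.single u 1))
  have hφ' : ∀ v, φ v = ∑ u, φ (Pi.single u 1) * v u := fun v => by
    have := linear_eq_sum (LinearMap.pi fun _ : Unit => φ) v ()
    simpa using this
  have hF : F = 0 := by
    refine eq_zero_of_torusEval fun t => ?_
    have := hker (hN t)
    rw [LinearMap.mem_ker, hφ'] at this
    simpa [F] using this
  have hc : ∀ u : A, φ (Pi.single u 1) = 0 := fun u => by
    have := congrArg (fun G : AddMonoidAlgebra k M => G.coeff (u : M)) hF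
    simpa [F, Finsupp.single_apply] using this
  ext u
  simp [hc]

end ToricVariety

end ToricGauss

end

/-- `X ⊆ ℙ^N` is projectively equivalent to the toric variety `X_A` by means of linear embeddings
`j₁`, `j₂` of the two ambient spaces into some `ℙ^L`. For `Y ⊆ X`, the set
`j₂⁻¹ (j₁ Y)` is the copy of `Y` in `X_A`. -/
theorem corollary1p3 {k : Type*} [Field k] [IsAlgClosed k] [CharZero k]
    {M : Type*} [AddCommGroup M] [Module.Free ℤ M] [Module.Finite ℤ M]
    (A : Finset M) (hA : A.Nonempty) (N L : ℕ)
    (X : Set (ℙ k (Fin (N + 1) → k)))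
    (j₁ : (Fin (N + 1) → k) →ₗ[k] (Fin (L + 1) → k)) (hj₁ : Function.Injective j₁)
    (j₂ : (A → k) →ₗ[k] (Fin (L + 1) → k)) (hj₂ : Function.Injective j₂)
    (hX : Projectivization.map j₁ hj₁ '' X =
      Projectivization.map j₂ hj₂ '' ToricGauss.toricVariety k A hA) :
    ∃ δ : ℕ, ToricGauss.IsGaussDefect X δ ∧
      ∃ Y : Fin (δ + 1) → Set (ℙ k (Fin (N + 1) → k)),
        (∀ i, ToricGauss.IsProjectiveVariety (Y i) ∧ Y i ⊆ X ∧
          ToricGauss.IsTorusInvariant A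
            (Projectivization.map j₂ hj₂ ⁻¹' (Projectivization.map j₁ hj₁ '' Y i))) ∧
        (∀ i i', i ≠ i' → Disjoint (Y i) (Y i')) ∧
        ToricGauss.join Y = X := by
  have : Nonempty A := hA.to_subtype
  -- The torus points of `X_A` span `k^A`, and `j₂` sends them into the range of `j₁`. Hence `j₂ =
  -- j₁ ∘ j` for an injective `j`, and `X` is the image of `X_A` under the single embedding `j`.
  have hrange : ∀ v, j₂ v ∈ LinearMap.range j₁ := by
    have htop := ToricGauss.eq_top_of_toricMap_mem A ((LinearMap.range j₁).comap j₂) fun t => by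
      have hmem : ToricGauss.toricMap A hA t ∈ ToricGauss.toricVariety k A hA :=
        subset_closure ⟨t, rfl⟩
      have h1 := Set.mem_image_of_mem (Projectivization.map j₂ hj₂) hmem
      rw [← hX] at h1
      obtain ⟨q, -, hq⟩ := h1
      induction q using Projectivization.ind with
      | h w hw =>
        rw [ToricGauss.toricMap, Projectivization.map_mk, Projectivization.map_mk,
          Projectivization.mk_eq_mk_iff] at hq
        obtain ⟨c, hc⟩ := hq
        refine ⟨(c⁻¹ : kˣ) • w, ?_⟩
        rw [Units.smul_def, map_smul, ← hc, ← Units.smul_def, inv_smul_smul]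
    intro v
    exact (htop ▸ Submodule.mem_top : v ∈ (LinearMap.range j₁).comap j₂)
  obtain ⟨r, hr⟩ := ToricGauss.exists_leftInverse j₁ hj₁
  set j := r ∘ₗ j₂
  have hj₁j : ∀ v, j₁ (j v) = j₂ v := by
    intro v
    obtain ⟨w, hw⟩ := hrange v
    rw [LinearMap.comp_apply, ← hw, hr]
  have hj : Function.Injective j := fun v w hvw => hj₂ (by rw [← hj₁j, ← hj₁j, hvw])
  have hmap : ∀ p, Projectivization.map j₁ hj₁ (Projectivization.map j hj p) =
      Projectivization.map j₂ hj₂ p := by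
    intro p
    induction p using Projectivization.ind with
    | h v hv => simp only [Projectivization.map_mk, hj₁j]
  have himage : ∀ Z, Projectivization.map j₁ hj₁ '' (Projectivization.map j hj '' Z) =
      Projectivization.map j₂ hj₂ '' Z := fun Z => by
    rw [Set.image_image]
    simp only [hmap]
  obtain rfl : X = Projectivization.map j hj '' ToricGauss.toricVariety k A hA :=
    (Projectivization.map_injective j₁ hj₁).image_injective (by rw [hX, himage])
  rw [ToricGauss.toricVariety_eq]
  obtain ⟨δ, hδ, Y, hY, hdisj, hjoin⟩ := ToricGauss.exists_join_decomposition (k := k)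
    (ToricGauss.height A) (ToricGauss.height_generator A) (ToricGauss.span_generator A)
  refine ⟨δ, hδ.map j hj, fun i => Projectivization.map j hj '' Y i,
    fun i => ⟨(hY i).1.map j hj, Set.image_mono (hY i).2.1, ?_⟩, fun i i' hi => ?_, ?_⟩
  · rw [himage, Set.preimage_image_eq _ (Projectivization.map_injective j₂ hj₂)]
    intro t y hy
    rw [← ToricGauss.torusMove_torusRestrict]
    exact (hY i).2.2 _ y hy
  · exact (Set.disjoint_image_iff (Projectivization.map_injective j hj)).2 (hdisj i i' hi)
  · rw [ToricGauss.join_map, hjoin]
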